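/- Let $n$ be a positive integer and identify the vertices of the complete graph $K_n$ with $\mathbb{Z}/n\mathbb{Z}$. For odd $n$ and $x\in[\frac{n-1}{2}]=\{1,\dots,\frac{n-1}{2}\}$, an edge of $K_n$ has type $x$ if it is of the form $\{v,v+x\}$; the vertex $v$ is then its (unique) starting vertex. The clockwise distance between two vertices $v,u\in\{1,\dots,n\}$ is $\min(|v-u|,\,n-|v-u|)$, and the clockwise distance $cd(e,e')$ between two edges is that between their starting vertices. For odd $n$ and $F\subseteq[\frac{n-1}{2}]$, a path $P$ in $K_n$ is called an $F$-separator path if 1. $P$ contains at least one edge of every type in $[\frac{n-1}{2}]$; 2. $P$ contains exactly two edges of each type $x\in F$; 3. whenever $x\neq y$ are in $F$, $e\ne e'$ are edges of $P$ of type $x$ and $h\neq h'$ are edges of $P$ of type $y$, we have $cd(e,e')\neq cd(h,h')$. The path $P$ has equally spaced $x$-type edges if, for some $m\geq 2$, it contains exactly $m$ edges of type $x$ and these can be listed as $e_1,\dots,e_m$ with $cd(e_i,e_{i+1})=\frac{n}{m}$ for all $i\in[m-1]$. **Theorem.** Let $n\equiv 3$ or $5 \pmod 6$. Then there are a set $F\subseteq[\frac{n-1}{2}]$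 and an $F$-separator path $P$ in $K_n$ such that $P$ has equally spaced $x$-type edges for no $x\in[\frac{n-1}{2}]$, and, with $D=[\frac{n-1}{2}]\setminus F$, $$|D\cup\{1\}|\leq\frac{5n+16\log_2 n+167}{32}.$$ -/

import Mathlib

/-! The vertices of `K_n` are the elements of `ZMod n`, placed clockwise on a regular polygon, and
`K_n` is `(⊤ : SimpleGraph (ZMod n))`. -/

/-- The edge types of `K_n`: the integers `1, …, ⌊n/2⌋`. -/
def edgeTypes (n : ℕ) : Finset ℕ := Finset.Icc 1 (n / 2)

/-- `e` is an `x`-type edge of `K_n` with starting vertex `v`: its endpoints are `v` and `v + x`. -/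
def IsTypeEdgeAt (n x : ℕ) (v : ZMod n) (e : Sym2 (ZMod n)) : Prop :=
  x ∈ edgeTypes n ∧ e = s(v, v + (x : ZMod n))

/-- `e` is an `x`-type edge of `K_n`. -/
def IsTypeEdge (n x : ℕ) (e : Sym2 (ZMod n)) : Prop :=
  ∃ v : ZMod n, IsTypeEdgeAt n x v e

/-- The `x`-type edges in the edge set `A`. -/
def typeEdges (n : ℕ) (A : Set (Sym2 (ZMod n))) (x : ℕ) : Set (Sym2 (ZMod n)) :=
  {e | e ∈ A ∧ IsTypeEdge n x e}

/-- The clockwise distance `min (|v - u|) (n - |v - u|)` between two vertices. The two residues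
`(v - u).val` and `(u - v).val` are `|v - u|` and `n - |v - u|` in some order when `u ≠ v`, and
both are `0` when `u = v`. -/
def clockDist (n : ℕ) (v u : ZMod n) : ℕ := min (v - u).val (u - v).val

/-- The distances between same-type edges of `A` do not repeat for different types: if `e, e'` are
distinct `x`-type edges of `A`, and `h, h'` distinct `y`-type edges of `A` with `y ≠ x`, then the
clockwise distances of the two pairs (measured between starting vertices) differ. This is the
condition for odd `n`, where starting vertices are unique. -/
def DistinctDistances (n : ℕ) (A : Set (Sym2 (ZMod n))) : Prop :=
  ∀ x y : ℕ, x ≠ y →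
    ∀ e ∈ A, ∀ e' ∈ A, ∀ h ∈ A, ∀ h' ∈ A, e ≠ e' → h ≠ h' →
      ∀ v v' u u' : ZMod n,
        IsTypeEdgeAt n x v e → IsTypeEdgeAt n x v' e' →
        IsTypeEdgeAt n y u h → IsTypeEdgeAt n y u' h' →
        clockDist n u u' ≠ clockDist n v v'

/-- For odd `n`, the edge set `A` is an `F`-separator for `K_n`: it contains an edge of every type,
exactly two edges of each type in `F`, and its edges with type in `F` have distinct distances.
The other half of the partition of the edge types is `edgeTypes n \ F`. -/
structure IsFSeparator (n : ℕ) (A : Set (Sym2 (ZMod n))) (F : Finset ℕ) : Prop where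
  subset_types : F ⊆ edgeTypes n
  exists_edge : ∀ y ∈ edgeTypes n, (typeEdges n A y).Nonempty
  two_edges : ∀ x ∈ F, (typeEdges n A x).ncard = 2
  distinct : DistinctDistances n {e | e ∈ A ∧ ∃ x ∈ F, IsTypeEdge n x e}

/-- `A` has equally spaced `x`-type edges: for some `m ≥ 2`, the set `A` contains exactly `m` edges
of type `x`, and they can be listed as `e₁, …, e_m` so that consecutive ones are at clockwise
distance exactly `n / m` (`s i` is the starting vertex of `e i`). -/
def HasEquallySpacedEdges (n : ℕ) (A : Set (Sym2 (ZMod n))) (x : ℕ) : Prop :=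
  ∃ m : ℕ, 2 ≤ m ∧ ∃ (e : Fin m → Sym2 (ZMod n)) (s : Fin m → ZMod n),
    Function.Injective e ∧ Set.range e = typeEdges n A x ∧
    (∀ i, IsTypeEdgeAt n x (s i) (e i)) ∧
    ∀ i j : Fin m, (j : ℕ) = (i : ℕ) + 1 → (clockDist n (s i) (s j) : ℚ) = (n : ℚ) / (m : ℚ)

/-! For `n ≥ 145`, write `n = 8t + 2r + 1` with `r < 4` and join five zigzags. In each of them one
end moves by 1 and the other by 3 in the opposite direction, so the edge lengths run through two
neighbouring residue classes mod 4, each edge starting at its left end. The first two zigzags both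
contain the types 2, 3 mod 4 with `x / 4 < J`; the next two both contain the types 0, 1 mod 4; the
last one covers the types 2, 3 mod 4 that remain. Three of the four links have type 1, and the one
between the third and fourth zigzags has type `b`.

In a doubled pair the roles of the steps 1 and 3 are exchanged: the left end moves by 3 in one
zigzag and by 1 in the other. The gap between the two starting vertices therefore drops by 2 each
time the type grows by 4, and the gaps of the two residue classes interleave. The first pair gives
the distances `J + 3, …, 3J + 2`, the second pair distances in `[b - 2t, b - 1]`. These are disjoint
once `b ≥ 2t + 3J + 3`, and below `n / 2` once `b` is (`fiveZigzagStart_sub_injOn`).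

The vertices are distinct (`fiveZigzag_injOn`) because the step-3 ends of the last three zigzags,
which overlap, lie in the classes `b`, `0`, `-b` mod 3 with `b` not divisible by 3; those of the
first two lie in neighbouring classes; all other ends fill separate intervals.

Outside `F` there remain about `2 (t - J)` types. Room on the circle allows `J` to be about `3t /
7`, which leaves roughly `n / 7 < 5n / 32` types (`exists_fiveZigzagParams`). Two edges are never
equally spaced since `n` is odd; the few types with more edges are handled by one pair of starts
whose difference has large additive order (`not_hasEquallySpacedEdges`). For `n < 145`, explicit
paths are verified by computation (`smallPaths_check`). -/

/-! ### Paths from vertex sequences, edge types and clockwise distance. -/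

/-- The edges `{w j, w (j + 1)}`, `j < K`, of the vertex sequence `w`. -/
def seqEdges {V : Type*} (w : ℕ → V) (K : ℕ) : Set (Sym2 V) :=
  {e | ∃ j < K, e = s(w j, w (j + 1))}

theorem exists_path_of_injOn {V : Type*} (w : ℕ → V) (K : ℕ)
    (hw : ∀ i ≤ K, ∀ j ≤ K, w i = w j → i = j) :
    ∃ P : (⊤ : SimpleGraph V).Walk (w 0) (w K), P.IsPath ∧
      (∀ v ∈ P.support, ∃ j ≤ K, v = w j) ∧ {e | e ∈ P.edges} = seqEdges w K := by
  induction K with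
  | zero =>
    refine ⟨.nil, by simp, by simp, ?_⟩
    ext e
    simp [seqEdges]
  | succ K ih =>
    obtain ⟨P, hP, hs, he⟩ := ih fun i hi j hj => hw i (by omega) j (by omega)
    have hadj : (⊤ : SimpleGraph V).Adj (w K) (w (K + 1)) := by
      rw [SimpleGraph.top_adj]
      intro h
      have := hw _ (by omega) _ le_rfl h
      omega
    refine ⟨P.concat hadj, hP.concat ?_ hadj, ?_, ?_⟩
    · intro h
      obtain ⟨j, hj, e⟩ := hs _ h
      have := hw _ le_rfl _ (by omega) e
      omega
    · intro v hv
      rw [SimpleGraph.Walk.support_concat, List.mem_append] at hv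
      rcases hv with hv | hv
      · obtain ⟨j, hj, e⟩ := hs _ hv
        exact ⟨j, by omega, e⟩
      · exact ⟨K + 1, le_rfl, by simpa using hv⟩
    · ext e
      have he' : e ∈ P.edges ↔ e ∈ seqEdges w K := by rw [← he]; rfl
      simp only [Set.mem_ofPred_eq, SimpleGraph.Walk.edges_concat, List.concat_eq_append,
        List.mem_append, he', seqEdges, List.mem_singleton]
      constructor
      · rintro (⟨j, hj, h⟩ | h)
        · exact ⟨j, by omega, h⟩
        · exact ⟨K, by omega, h⟩
      · rintro ⟨j, hj, h⟩
        rcases Nat.lt_succ_iff_lt_or_eq.mp hj with h' | rfl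
        · exact .inl ⟨j, h', h⟩
        · exact .inr h

/-- Reading an edge in both directions would force `n ∣ x + y`, but for odd `n` two types add up to
at most `n - 1`. -/
theorem typeEdge_unique {n x y : ℕ} (hn : n % 2 = 1) {u v : ZMod n} {e : Sym2 (ZMod n)}
    (h₁ : IsTypeEdgeAt n x u e) (h₂ : IsTypeEdgeAt n y v e) : x = y ∧ u = v := by
  obtain ⟨hx, rfl⟩ := h₁
  obtain ⟨hy, h⟩ := h₂
  simp only [edgeTypes, Finset.mem_Icc] at hx hy
  rcases Sym2.eq_iff.mp h with ⟨rfl, h'⟩ | ⟨h', h''⟩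
  · refine ⟨?_, rfl⟩
    have := (ZMod.natCast_eq_natCast_iff' x y n).mp (add_left_cancel h')
    rwa [Nat.mod_eq_of_lt (by omega), Nat.mod_eq_of_lt (by omega)] at this
  · exfalso
    have h0 : ((x + y : ℕ) : ZMod n) = 0 := by
      push_cast
      linear_combination h'' - h'
    rw [ZMod.natCast_eq_zero_iff] at h0
    have := Nat.le_of_dvd (by omega) h0
    omega

theorem clockDist_comm (n : ℕ) (u v : ZMod n) : clockDist n u v = clockDist n v u :=
  min_comm _ _

theorem clockDist_eq {n k : ℕ} {u v : ZMod n} (h : u - v = (k : ZMod n)) (hk : 2 * k < n) :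
    clockDist n u v = k := by
  have : NeZero n := ⟨by omega⟩
  have h' : v - u = -(k : ZMod n) := by rw [← h]; ring
  rw [clockDist, h, h', ZMod.neg_val, ZMod.val_natCast_of_lt (by omega)]
  split_ifs with h0
  · have := congrArg ZMod.val h0
    rw [ZMod.val_natCast_of_lt (by omega), ZMod.val_zero] at this
    omega
  · omega

/-- Modulo `n` the clockwise distance is `±(u - v)`, so equal spacing forces consecutive starts to
agree after multiplication by `m`. -/
theorem mul_clockDist {n m : ℕ} [NeZero n] {u v : ZMod n} (h : m * clockDist n u v = n) :
    (m : ZMod n) * u = m * v := by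
  have hc : (m : ZMod n) * (clockDist n u v : ZMod n) = 0 := by
    rw [← Nat.cast_mul, h, ZMod.natCast_self]
  rcases min_choice (u - v).val (v - u).val with h' | h' <;>
    rw [clockDist, h', ZMod.natCast_zmod_val] at hc
  · linear_combination hc
  · linear_combination -hc

/-! ### Reduction to a relation between types and starting vertices. -/

/-- The set of edges `{v, v + x}` over all pairs `(x, v)` related by `R`. -/
def relEdges (n : ℕ) (R : ℕ → ℤ → Prop) : Set (Sym2 (ZMod n)) :=
  {e | ∃ (x : ℕ) (v : ℤ), R x v ∧ e = s((v : ZMod n), (v : ZMod n) + (x : ZMod n))}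

theorem mem_typeEdges_relEdges {n : ℕ} {R : ℕ → ℤ → Prop} (hn : n % 2 = 1)
    (hR : ∀ x v, R x v → x ∈ edgeTypes n) {x : ℕ} {e : Sym2 (ZMod n)} :
    e ∈ typeEdges n (relEdges n R) x ↔ ∃ v : ℤ, R x v ∧ IsTypeEdgeAt n x v e := by
  constructor
  · rintro ⟨⟨y, v, h, he⟩, u, hu⟩
    obtain ⟨rfl, -⟩ := typeEdge_unique hn hu ⟨hR _ _ h, he⟩
    exact ⟨v, h, hR _ _ h, he⟩
  · rintro ⟨v, h, he⟩
    exact ⟨⟨x, v, h, he.2⟩, v, he⟩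

theorem exists_start {n : ℕ} {R : ℕ → ℤ → Prop} (hn : n % 2 = 1)
    (hR : ∀ x v, R x v → x ∈ edgeTypes n) {x : ℕ} {u : ZMod n} {e : Sym2 (ZMod n)}
    (he : e ∈ relEdges n R) (h : IsTypeEdgeAt n x u e) : ∃ v : ℤ, R x v ∧ u = v := by
  obtain ⟨v, h', hv⟩ := (mem_typeEdges_relEdges hn hR).mp ⟨he, u, h⟩
  exact ⟨v, h', (typeEdge_unique hn h hv).2⟩

/-- A type `x` whose edges start in a finite set `S` is not equally spaced if `S` has at most two
elements, or if some two starting vertices have a difference of additive order above `#S`. -/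
theorem not_hasEquallySpacedEdges {n : ℕ} {R : ℕ → ℤ → Prop} (hn : n % 2 = 1)
    (hR : ∀ x v, R x v → x ∈ edgeTypes n) {x : ℕ} (S : Finset ℤ) (hS : ∀ v, R x v → v ∈ S)
    (h : S.card ≤ 2 ∨ ∃ u v, R x u ∧ R x v ∧
      ∀ m : ℕ, 0 < m → m ≤ S.card → ¬ (n : ℤ) ∣ m * (u - v)) :
    ¬ HasEquallySpacedEdges n (relEdges n R) x := by
  rintro ⟨m, hm, e, s, hinj, hrange, hs, hd⟩
  have : NeZero n := ⟨by omega⟩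
  have hmS : m ≤ S.card := by
    have h1 : (Set.range e).ncard = m := by
      rw [← Set.image_univ, Set.ncard_image_of_injective _ hinj, Set.ncard_univ, Nat.card_fin]
    rw [← h1, ← Set.ncard_coe_finset S]
    have h2 : Set.range e ⊆ (fun v : ℤ => s((v : ZMod n), (v : ZMod n) + (x : ZMod n))) '' S := by
      rw [hrange]
      intro a ha
      obtain ⟨v, hv, h'⟩ := (mem_typeEdges_relEdges hn hR).mp ha
      exact ⟨v, hS _ hv, h'.2.symm⟩
    exact (Set.ncard_le_ncard h2 (S.finite_toSet.image _)).trans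
      (Set.ncard_image_le S.finite_toSet)
  have hd' : ∀ i j : Fin m, (j : ℕ) = i + 1 → m * clockDist n (s i) (s j) = n := by
    intro i j hij
    have := hd i j hij
    rw [eq_div_iff (by positivity)] at this
    rw [mul_comm]
    exact_mod_cast this
  rcases h with h | ⟨u, v, hu, hv, h⟩
  -- Two equally spaced edges would satisfy `2 * clockDist = n`, against `n` odd.
  · have hm2 : m = 2 := by omega
    subst hm2
    have := hd' 0 1 rfl
    omega
  · have hall : ∀ i : ℕ, ∀ hi : i < m, (m : ZMod n) * s ⟨i, hi⟩ = m * s ⟨0, by omega⟩ := by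
      intro i
      induction i with
      | zero => intro _; rfl
      | succ i ih =>
        intro hi
        rw [← ih (by omega)]
        exact (mul_clockDist (hd' _ _ rfl)).symm
    have hone : ∀ v : ℤ, R x v → (m : ZMod n) * v = m * s ⟨0, by omega⟩ := by
      intro v hv
      have hat : IsTypeEdgeAt n x v s((v : ZMod n), (v : ZMod n) + (x : ZMod n)) := ⟨hR _ _ hv, rfl⟩
      have : s((v : ZMod n), (v : ZMod n) + (x : ZMod n)) ∈ Set.range e := by
        rw [hrange]
        exact (mem_typeEdges_relEdges hn hR).mpr ⟨v, hv, hat⟩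
      obtain ⟨i, hi⟩ := this
      have h1 := hs i
      rw [hi] at h1
      rw [(typeEdge_unique hn hat h1).2]
      exact hall i i.2
    refine h m (by omega) hmS ?_
    rw [← ZMod.intCast_zmod_eq_zero_iff_dvd]
    push_cast
    rw [mul_sub, hone u hu, hone v hv, sub_self]

/-- The conclusion of the main theorem, with the bound on `|D ∪ {1}|` in integer form. -/
def HasSeparatorPath (n : ℕ) : Prop :=
  ∃ (a b : ZMod n) (P : (⊤ : SimpleGraph (ZMod n)).Walk a b) (F : Finset ℕ),
    P.IsPath ∧ IsFSeparator n {e | e ∈ P.edges} F ∧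
    (∀ x ∈ edgeTypes n, ¬ HasEquallySpacedEdges n {e | e ∈ P.edges} x) ∧
    32 * ((edgeTypes n \ F) ∪ {1}).card ≤ 5 * n + 16 * Nat.log 2 n + 167

/-- A representative `k x` of the difference of the two starts lying in `(0, n / 2)` is their
clockwise distance, so the distance condition becomes injectivity of `k`. -/
theorem isFSeparator_relEdges {n : ℕ} {R : ℕ → ℤ → Prop} (hn : n % 2 = 1)
    (hR : ∀ x v, R x v → x ∈ edgeTypes n) (hcov : ∀ x ∈ edgeTypes n, ∃ v, R x v)
    (F : Finset ℕ) (v₁ v₂ : ℕ → ℤ) (k : ℕ → ℕ)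
    (h₁ : ∀ x ∈ F, R x (v₁ x)) (h₂ : ∀ x ∈ F, R x (v₂ x))
    (h₁₂ : ∀ x ∈ F, ∀ v, R x v → v = v₁ x ∨ v = v₂ x)
    (hk : ∀ x ∈ F, 0 < k x ∧ 2 * k x < n ∧ ((v₁ x - v₂ x : ℤ) : ZMod n) = k x)
    (hinj : ∀ x ∈ F, ∀ y ∈ F, k x = k y → x = y) :
    IsFSeparator n (relEdges n R) F where
  subset_types x hx := hR _ _ (h₁ x hx)
  exists_edge y hy := by
    obtain ⟨v, hv⟩ := hcov y hy
    exact ⟨_, (mem_typeEdges_relEdges hn hR).mpr ⟨v, hv, hy, rfl⟩⟩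
  two_edges x hx := by
    have hty := hR _ _ (h₁ x hx)
    rw [Set.ncard_eq_two]
    refine ⟨_, _, ?_, (?_ : _ = {s((v₁ x : ZMod n), (v₁ x : ZMod n) + (x : ZMod n)),
      s((v₂ x : ZMod n), (v₂ x : ZMod n) + (x : ZMod n))})⟩
    · intro h
      have h' := (typeEdge_unique hn (⟨hty, rfl⟩ : IsTypeEdgeAt n x _ _) ⟨hty, h⟩).2
      obtain ⟨h0, hlt, h3⟩ := hk x hx
      push_cast at h3
      rw [h', sub_self, eq_comm, ZMod.natCast_eq_zero_iff] at h3
      have := Nat.le_of_dvd h0 h3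
      omega
    · ext e
      rw [mem_typeEdges_relEdges hn hR]
      constructor
      · rintro ⟨v, hv, -, rfl⟩
        rcases h₁₂ x hx v hv with rfl | rfl
        · exact .inl rfl
        · exact .inr rfl
      · rintro (rfl | rfl)
        · exact ⟨_, h₁ x hx, hty, rfl⟩
        · exact ⟨_, h₂ x hx, hty, rfl⟩
  distinct := by
    have key : ∀ x e e' (v v' : ZMod n), e ∈ relEdges n R → (∃ z ∈ F, IsTypeEdge n z e) →
        e' ∈ relEdges n R → e ≠ e' → IsTypeEdgeAt n x v e → IsTypeEdgeAt n x v' e' →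
        x ∈ F ∧ clockDist n v v' = k x := by
      rintro x e e' v v' he ⟨z, hz, a, ha⟩ he' hne hv hv'
      obtain ⟨rfl, -⟩ := typeEdge_unique hn ha hv
      refine ⟨hz, ?_⟩
      obtain ⟨u, hu, rfl⟩ := exists_start hn hR he hv
      obtain ⟨u', hu', rfl⟩ := exists_start hn hR he' hv'
      obtain ⟨-, hlt, h3⟩ := hk _ hz
      push_cast at h3
      have hne' : u ≠ u' := by
        rintro rfl
        exact hne (hv.2.trans hv'.2.symm)
      rcases h₁₂ _ hz _ hu with rfl | rfl <;> rcases h₁₂ _ hz _ hu' with rfl | rfl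
      · exact absurd rfl hne'
      · exact clockDist_eq h3 hlt
      · rw [clockDist_comm]
        exact clockDist_eq h3 hlt
      · exact absurd rfl hne'
    rintro x y hxy e ⟨he, heF⟩ e' ⟨he', -⟩ f ⟨hf, hfF⟩ f' ⟨hf', -⟩ hne hne' v v' u u' hv hv' hu hu'
    obtain ⟨hx, h1⟩ := key x e e' v v' he heF he' hne hv hv'
    obtain ⟨hy, h2⟩ := key y f f' u u' hf hfF hf' hne' hu hu'
    rw [h1, h2]
    exact fun h => hxy (hinj y hy x hx h).symm

theorem hasSeparatorPath_of_rel {n : ℕ} {R : ℕ → ℤ → Prop} (hn : n % 2 = 1)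
    (w : ℕ → ZMod n) (K : ℕ) (hw : ∀ i ≤ K, ∀ j ≤ K, w i = w j → i = j)
    (hE : seqEdges w K = relEdges n R)
    (hR : ∀ x v, R x v → x ∈ edgeTypes n) (hcov : ∀ x ∈ edgeTypes n, ∃ v, R x v)
    (F : Finset ℕ) (v₁ v₂ : ℕ → ℤ) (k : ℕ → ℕ)
    (h₁ : ∀ x ∈ F, R x (v₁ x)) (h₂ : ∀ x ∈ F, R x (v₂ x))
    (h₁₂ : ∀ x ∈ F, ∀ v, R x v → v = v₁ x ∨ v = v₂ x)
    (hk : ∀ x ∈ F, 0 < k x ∧ 2 * k x < n ∧ ((v₁ x - v₂ x : ℤ) : ZMod n) = k x)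
    (hinj : ∀ x ∈ F, ∀ y ∈ F, k x = k y → x = y)
    (hS : ∀ x ∈ edgeTypes n, x ∉ F → ∃ S : Finset ℤ, (∀ v, R x v → v ∈ S) ∧
      (S.card ≤ 2 ∨ ∃ u v, R x u ∧ R x v ∧
        ∀ m : ℕ, 0 < m → m ≤ S.card → ¬ (n : ℤ) ∣ m * (u - v)))
    (hcard : 32 * ((edgeTypes n \ F) ∪ {1}).card ≤ 5 * n + 16 * Nat.log 2 n + 167) :
    HasSeparatorPath n := by
  obtain ⟨P, hP, -, he⟩ := exists_path_of_injOn w K hw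
  refine ⟨_, _, P, F, hP, ?_, ?_, hcard⟩
  · rw [he, hE]
    exact isFSeparator_relEdges hn hR hcov F v₁ v₂ k h₁ h₂ h₁₂ hk hinj
  · intro x hx
    rw [he, hE]
    by_cases hxF : x ∈ F
    · refine not_hasEquallySpacedEdges hn hR {v₁ x, v₂ x} (fun v hv => ?_) (.inl Finset.card_le_two)
      simpa using h₁₂ x hxF v hv
    · obtain ⟨S, h, h'⟩ := hS x hx hxF
      exact not_hasEquallySpacedEdges hn hR S h h'

theorem HasSeparatorPath.of_integer_bound {n : ℕ} (h : HasSeparatorPath n) :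
    ∃ (a b : ZMod n) (P : (⊤ : SimpleGraph (ZMod n)).Walk a b) (F : Finset ℕ),
      P.IsPath ∧
      IsFSeparator n {e | e ∈ P.edges} F ∧
      (∀ x ∈ edgeTypes n, ¬ HasEquallySpacedEdges n {e | e ∈ P.edges} x) ∧
      ((((edgeTypes n \ F) ∪ {1}).card : ℕ) : ℝ) ≤
        (5 * (n : ℝ) + 16 * Real.logb 2 (n : ℝ) + 167) / 32 := by
  obtain ⟨a, b, P, F, h1, h2, h3, h4⟩ := h
  refine ⟨a, b, P, F, h1, h2, h3, ?_⟩
  have hl : (Nat.log 2 n : ℝ) ≤ Real.logb 2 n := by exact_mod_cast Real.natLog_le_logb n 2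
  have h4' : 32 * ((((edgeTypes n \ F) ∪ {1}).card : ℕ) : ℝ) ≤ 5 * n + 16 * Nat.log 2 n + 167 := by
    exact_mod_cast h4
  rw [le_div_iff₀ (by norm_num)]
  linarith

/-! ### Small `n`: the table of paths and its Boolean test. -/

/-- The first `l` terms of the alternating sequence `x, y, x + p, y + q, x + 2p, …` modulo `n`. -/
def zigzag (n : ℕ) : ℕ → ℕ → ℕ → ℕ → ℕ → List ℕ
  | 0, _, _, _, _ => []
  | l + 1, x, y, p, q => x :: zigzag n l y ((x + p) % n) q p

/-- Concatenation of the zigzags with parameters `(x, y, p, q, l)`. -/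
def zigzags (n : ℕ) (Z : List (ℕ × ℕ × ℕ × ℕ × ℕ)) : List ℕ :=
  Z.flatMap fun z => zigzag n z.2.2.2.2 z.1 z.2.1 z.2.2.1 z.2.2.2.1

/-- Type and starting vertex of the edge `{u, v}`. -/
def typeStart (n u v : ℕ) : ℕ × ℕ :=
  bif Nat.ble ((v + n - u) % n) (n / 2) then ((v + n - u) % n, u) else ((u + n - v) % n, v)

/-- Types and starting vertices of the edges of a vertex sequence. -/
def typeStarts (n : ℕ) : List ℕ → List (ℕ × ℕ)
  | [] => []
  | u :: L => match L with
    | [] => []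
    | v :: _ => typeStart n u v :: typeStarts n L

/-- `p` holds for all entries of the list. -/
def listAll {α : Type} (p : α → Bool) (L : List α) : Bool :=
  List.rec true (fun a _ ih => bif p a then ih else false) L

/-- `p` holds for all numbers below `n`. -/
def allBelow (p : ℕ → Bool) (n : ℕ) : Bool :=
  Nat.rec true (fun k ih => bif p k then ih else false) n

/-- The entries of the list are distinct. -/
def allDistinct (L : List ℕ) : Bool :=
  List.rec true (fun a L ih => bif listAll (fun b => !Nat.beq a b) L then ih else false) L

/-- Starting vertices of the edges of type `x`. -/
def startsOf (E : List (ℕ × ℕ)) (x : ℕ) : List ℕ :=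
  List.rec [] (fun e _ ih => bif Nat.beq e.1 x then e.2 :: ih else ih) E

/-- The two entries of a list of length two, ordered so that the first is at most `n / 2` steps
clockwise of the second. -/
def orientedPair (n : ℕ) : List ℕ → ℕ × ℕ
  | [a, b] => bif Nat.ble ((a + n - b) % n) (n / 2) then (a, b) else (b, a)
  | _ => (0, 0)

/-- Clockwise distance of the entries of a list of length two. -/
def pairDist (n : ℕ) (S : List ℕ) : ℕ := ((orientedPair n S).1 + n - (orientedPair n S).2) % n

/-- Types `x ∈ [2, N]` with exactly two edges, and pairwise different distances, together with
these distances. -/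
def separatedTypes (n : ℕ) (E : List (ℕ × ℕ)) (N : ℕ) : List (ℕ × ℕ) :=
  Nat.rec [] (fun x ih =>
    bif !Nat.beq x 0 && Nat.beq (startsOf E (x + 1)).length 2 &&
      !Nat.beq (pairDist n (startsOf E (x + 1))) 0 &&
      listAll (fun p => !Nat.beq p.2 (pairDist n (startsOf E (x + 1)))) ih
    then (x + 1, pairDist n (startsOf E (x + 1))) :: ih else ih) N

/-- Whether the list is not equally spaced because of its length or of two of its entries. -/
def spacingCheck (n : ℕ) (S : List ℕ) : Bool :=
  bif Nat.ble S.length 2 then true else S.any fun u => S.any fun v =>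
    allBelow (fun m => !Nat.beq ((m + 1) * (u + n - v) % n) 0) S.length

/-- Boolean test for the vertex sequence `L` to be a path as required. -/
def pathCheck (n : ℕ) (L : List ℕ) : Bool :=
  Nat.beq (n % 2) 1 && !Nat.beq L.length 0 && listAll (fun v => Nat.blt v n) L && allDistinct L &&
  allBelow (fun x => !Nat.beq (startsOf (typeStarts n L) (x + 1)).length 0 &&
    spacingCheck n (startsOf (typeStarts n L) (x + 1))) (n / 2) &&
  Nat.ble (32 * (n / 2)) (5 * n + 16 * Nat.log2 n + 167 +
    32 * (separatedTypes n (typeStarts n L) (n / 2)).length)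

/-- Paths for small `n`, as concatenations of zigzags. -/
def smallPaths : List (ℕ × List (ℕ × ℕ × ℕ × ℕ × ℕ)) := [
    (3, [(0, 2, 1, 2, 2)]),
    (5, [(0, 4, 1, 4, 3)]),
    (9, [(0, 8, 1, 8, 5)]),
    (11, [(0, 10, 1, 10, 6)]),
    (15, [(0, 14, 1, 14, 8)]),
    (17, [(0, 16, 1, 16, 9)]),
    (21, [(0, 20, 1, 20, 11)]),
    (23, [(0, 22, 1, 22, 12), (8, 6, 2, 18, 3)]),
    (27, [(0, 26, 1, 26, 14), (18, 14, 26, 24, 7)]),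
    (29, [(0, 28, 1, 28, 15), (19, 10, 26, 27, 5)]),
    (33, [(0, 32, 1, 32, 17), (23, 16, 31, 1, 6)]),
    (35, [(0, 34, 1, 34, 18), (24, 13, 33, 34, 11)]),
    (39, [(0, 38, 1, 38, 20), (19, 26, 37, 34, 8)]),
    (41, [(0, 40, 1, 40, 21), (13, 26, 4, 3, 5), (20, 14, 40, 1, 4)]),
    (45, [(0, 44, 1, 44, 23), (33, 25, 43, 40, 7), (23, 30, 1, 43, 2), (32, 18, 44, 2, 2)]),
    (47, [(0, 46, 1, 46, 24), (30, 13, 2, 5, 6), (31, 29, 2, 3, 3)]),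
    (51, [(0, 50, 1, 50, 26), (34, 17, 46, 47, 5), (16, 37, 4, 48, 2), (30, 28, 4, 3, 2), (15,
      20, 5, 46, 2)]),
    (53, [(0, 52, 1, 52, 27), (34, 28, 1, 50, 11), (23, 14, 50, 1, 5), (21, 18, 48, 49, 2)]),
    (57, [(0, 56, 1, 56, 29), (37, 16, 1, 4, 12), (17, 15, 2, 4, 3), (22, 23, 2, 5, 2), (30, 35,
      56, 2, 2)]),
    (59, [(0, 58, 1, 58, 30), (15, 19, 1, 3, 8), (39, 29, 4, 57, 4), (42, 21, 54, 58, 5), (23,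
      41, 55, 58, 2)]),
    (63, [(43, 41, 1, 60, 6), (34, 36, 62, 3, 5), (31, 2, 62, 3, 16), (0, 62, 3, 62, 16), (54,
      1, 62, 3, 13)]),
    (65, [(0, 64, 1, 64, 33), (45, 29, 1, 5, 8), (26, 24, 5, 62, 7), (22, 25, 63, 63, 4), (17,
      33, 64, 60, 2)]),
    (69, [(0, 68, 1, 68, 35), (38, 24, 66, 67, 9), (19, 45, 4, 3, 7), (47, 50, 64, 3, 2), (46,
      44, 1, 67, 2)]),
    (71, [(0, 70, 1, 70, 36), (46, 30, 1, 3, 12), (24, 43, 5, 1, 2), (18, 20, 66, 4, 2), (23,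
      37, 2, 1, 2)]),
    (75, [(44, 7, 74, 3, 20), (0, 74, 3, 74, 20), (58, 5, 74, 3, 9), (62, 52, 1, 72, 6), (48,
      45, 74, 3, 3), (2, 50, 74, 3, 4), (60, 4, 2, 73, 2), (26, 20, 1, 74, 2)]),
    (77, [(0, 76, 1, 76, 39), (48, 26, 74, 76, 15), (51, 28, 1, 2, 2), (57, 54, 1, 73, 2), (56,
      52, 76, 75, 2)]),
    (81, [(45, 4, 80, 3, 22), (0, 80, 3, 80, 22), (11, 65, 3, 80, 16), (51, 69, 3, 80, 6), (48,
      46, 1, 78, 3), (56, 50, 78, 3, 3), (47, 66, 2, 80, 2), (8, 55, 3, 1, 2)]),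
    (83, [(59, 57, 1, 80, 8), (47, 49, 82, 3, 7), (43, 2, 82, 3, 22), (0, 82, 3, 82, 22), (71,
      70, 82, 1, 1), (70, 1, 82, 3, 15)]),
    (87, [(61, 59, 1, 84, 8), (49, 51, 86, 3, 7), (45, 4, 86, 3, 22), (0, 86, 3, 86, 22), (75,
      2, 86, 3, 17)]),
    (89, [(63, 61, 1, 86, 8), (51, 53, 88, 3, 7), (47, 2, 88, 3, 24), (0, 88, 3, 88, 24), (76,
      1, 88, 3, 17)]),
    (93, [(63, 61, 1, 90, 8), (51, 53, 92, 3, 7), (47, 2, 92, 3, 24), (0, 92, 3, 92, 24), (80,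
      1, 92, 3, 18)]),
    (95, [(69, 67, 1, 92, 10), (54, 56, 94, 3, 9), (49, 4, 94, 3, 24), (0, 94, 3, 94, 24), (82,
      5, 94, 3, 17)]),
    (99, [(54, 5, 98, 3, 26), (0, 98, 3, 98, 26), (55, 37, 1, 96, 17), (65, 80, 1, 96, 9), (72,
      82, 3, 98, 4)]),
    (101, [(74, 72, 1, 98, 10), (59, 61, 100, 3, 9), (54, 5, 100, 3, 26), (0, 100, 3, 100, 26),
      (87, 4, 100, 3, 18)]),
    (105, [(61, 8, 104, 3, 28), (0, 104, 3, 104, 28), (22, 76, 3, 104, 18), (87, 77, 1, 103, 3),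
      (84, 82, 1, 102, 5), (83, 65, 102, 3, 3), (78, 64, 104, 102, 2), (90, 16, 1, 104, 2), (62,
      81, 1, 104, 3)]),
    (107, [(77, 75, 1, 104, 10), (62, 64, 106, 3, 9), (57, 4, 106, 3, 28), (0, 106, 3, 106, 28),
      (92, 91, 106, 2, 1), (91, 2, 106, 3, 19)]),
    (111, [(77, 75, 1, 108, 10), (62, 64, 110, 3, 9), (57, 4, 110, 3, 28), (0, 110, 3, 110, 28),
      (96, 95, 110, 2, 1), (95, 2, 110, 3, 21)]),
    (113, [(78, 76, 1, 110, 10), (63, 65, 112, 3, 9), (58, 1, 112, 3, 30), (0, 112, 3, 112, 30),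
      (97, 2, 112, 3, 21)]),
    (117, [(85, 83, 1, 114, 12), (67, 69, 116, 3, 11), (61, 4, 116, 3, 30), (0, 116, 3, 116,
      30), (101, 100, 116, 5, 1), (100, 5, 116, 3, 20)]),
    (119, [(85, 83, 1, 116, 12), (67, 69, 118, 3, 11), (61, 4, 118, 3, 30), (0, 118, 3, 118,
      30), (103, 102, 118, 5, 1), (102, 5, 118, 3, 21)]),
    (123, [(89, 87, 1, 120, 12), (71, 73, 122, 3, 11), (65, 4, 122, 3, 32), (0, 122, 3, 122,
      32), (106, 5, 122, 3, 21)]),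
    (125, [(90, 88, 1, 122, 12), (72, 74, 124, 3, 11), (66, 5, 124, 3, 32), (0, 124, 3, 124,
      32), (108, 107, 124, 4, 1), (107, 4, 124, 3, 22)]),
    (129, [(91, 89, 1, 126, 12), (73, 75, 128, 3, 11), (67, 2, 128, 3, 34), (0, 128, 3, 128,
      34), (111, 4, 128, 3, 23)]),
    (131, [(91, 89, 1, 128, 12), (73, 75, 130, 3, 11), (67, 2, 130, 3, 34), (0, 130, 3, 130,
      34), (113, 4, 130, 3, 23)]),
    (135, [(98, 96, 1, 132, 14), (77, 79, 134, 3, 13), (70, 5, 134, 3, 34), (0, 134, 3, 134,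
      34), (117, 116, 134, 7, 1), (116, 7, 134, 3, 23)]),
    (137, [(94, 92, 1, 134, 12), (76, 78, 136, 3, 11), (70, 1, 136, 3, 36), (0, 136, 3, 136,
      36), (118, 117, 136, 2, 1), (117, 2, 136, 3, 25)]),
    (141, [(102, 100, 1, 138, 14), (81, 83, 140, 3, 13), (74, 5, 140, 3, 36), (0, 140, 3, 140,
      36), (122, 7, 140, 3, 24)]),
    (143, [(102, 100, 1, 140, 14), (81, 83, 142, 3, 13), (74, 5, 142, 3, 36), (0, 142, 3, 142,
      36), (124, 7, 142, 3, 25)])]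

-- The whole table is evaluated in the kernel; the tests are built from recursors and `bif` so that
-- they reduce by plain computation.
set_option maxRecDepth 100000 in
theorem smallPaths_check : ∀ p ∈ smallPaths, pathCheck p.1 (zigzags p.1 p.2) = true := by
  decide +kernel

/-! ### Soundness of the Boolean test. -/

theorem bif_else_false (a b : Bool) : (bif a then b else false) = (a && b) := by
  cases a <;> rfl

theorem allBelow_iff {p : ℕ → Bool} {n : ℕ} : allBelow p n = true ↔ ∀ k < n, p k = true := by
  induction n with
  | zero => simp [allBelow]
  | succ n ih =>
    have : allBelow p (n + 1) = bif p n then allBelow p n else false := rfl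
    rw [this, bif_else_false, Bool.and_eq_true, ih]
    constructor
    · rintro ⟨h, h'⟩ k hk
      rcases Nat.lt_succ_iff_lt_or_eq.mp hk with hk | rfl
      · exact h' k hk
      · exact h
    · exact fun h => ⟨h n (by omega), fun k hk => h k (by omega)⟩

theorem listAll_iff {α : Type} {p : α → Bool} {L : List α} :
    listAll p L = true ↔ ∀ a ∈ L, p a = true := by
  induction L with
  | nil => simp [listAll]
  | cons a L ih =>
    have : listAll p (a :: L) = bif p a then listAll p L else false := rfl
    rw [this, bif_else_false, Bool.and_eq_true, ih]
    simp

theorem nodup_of_allDistinct {L : List ℕ} (h : allDistinct L = true) : L.Nodup := by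
  induction L with
  | nil => simp
  | cons a L ih =>
    have : allDistinct (a :: L) =
      bif listAll (fun b => !Nat.beq a b) L then allDistinct L else false := rfl
    rw [this, bif_else_false, Bool.and_eq_true, listAll_iff] at h
    refine List.nodup_cons.mpr ⟨fun ha => ?_, ih h.2⟩
    simpa using h.1 a ha

theorem mem_startsOf {E : List (ℕ × ℕ)} {x v : ℕ} : v ∈ startsOf E x ↔ (x, v) ∈ E := by
  induction E with
  | nil => simp [startsOf]
  | cons e E ih =>
    have : startsOf (e :: E) x =
      bif Nat.beq e.1 x then e.2 :: startsOf E x else startsOf E x := rfl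
    obtain ⟨y, u⟩ := e
    rw [this]
    by_cases h : y = x
    · subst h
      simp [ih]
    · have h' : Nat.beq y x = false := by rw [Bool.eq_false_iff, ne_eq, Nat.beq_eq]; exact h
      have h'' : x ≠ y := fun e => h e.symm
      simp [h', ih, h'']

theorem mem_typeStarts {n : ℕ} {L : List ℕ} {e : ℕ × ℕ} :
    e ∈ typeStarts n L ↔ ∃ j, j + 1 < L.length ∧ e = typeStart n (L.getD j 0) (L.getD (j + 1) 0) := by
  induction L with
  | nil => simp [typeStarts]
  | cons u L ih =>
    cases L with
    | nil => simp [typeStarts]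
    | cons v L =>
      rw [typeStarts, List.mem_cons, ih]
      constructor
      · rintro (h | ⟨j, hj, h⟩)
        · exact ⟨0, by simp, h⟩
        · exact ⟨j + 1, by simpa using hj, h⟩
      · rintro ⟨_ | j, hj, h⟩
        · exact .inl h
        · exact .inr ⟨j, by simpa using hj, h⟩

theorem natCast_mod_sub {n a b : ℕ} (h : b ≤ a + n) :
    (((a + n - b) % n : ℕ) : ZMod n) = (a : ZMod n) - b := by
  rw [ZMod.natCast_mod, Nat.cast_sub h]
  simp

theorem typeStart_spec {n u v : ℕ} (hu : u < n) (hv : v < n) (huv : u ≠ v) :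
    (typeStart n u v).1 ∈ edgeTypes n ∧ (typeStart n u v).2 < n ∧
      s((u : ZMod n), (v : ZMod n)) = s(((typeStart n u v).2 : ZMod n),
        ((typeStart n u v).2 : ZMod n) + ((typeStart n u v).1 : ZMod n)) := by
  have key : ∀ a b : ℕ, a < n → b < n → a ≠ b →
      ((a + n - b) % n = a - b ∧ b < a) ∨ ((a + n - b) % n = a + n - b ∧ a < b) := by
    intro a b ha hb hab
    rcases Nat.lt_or_ge a b with h | h
    · exact .inr ⟨Nat.mod_eq_of_lt (by omega), h⟩
    · refine .inl ⟨?_, by omega⟩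
      rw [show a + n - b = a - b + n by omega, Nat.add_mod_right, Nat.mod_eq_of_lt (by omega)]
  have h1 := key v u hv hu huv.symm
  have h2 := key u v hu hv huv
  rw [typeStart, edgeTypes, Finset.mem_Icc]
  rcases hb : Nat.ble ((v + n - u) % n) (n / 2) with _ | _
  · have : ¬ (v + n - u) % n ≤ n / 2 := by
      rw [← Nat.ble_eq, hb]
      simp
    refine ⟨?_, hv, ?_⟩
    · simp only [cond_false]
      omega
    · simp only [cond_false]
      rw [natCast_mod_sub (by omega), add_sub_cancel, Sym2.eq_swap]
  · have := Nat.le_of_ble_eq_true hb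
    refine ⟨?_, hu, ?_⟩
    · simp only [cond_true]
      omega
    · simp only [cond_true]
      rw [natCast_mod_sub (by omega), add_sub_cancel]

/-- The selection is greedy: a type is accepted only if its distance is new, which makes distances
injective. Type 1 is never accepted, so that adjoining 1 to the complement costs nothing. -/
theorem separatedTypes_spec (n : ℕ) (E : List (ℕ × ℕ)) (N : ℕ) :
    (∀ p ∈ separatedTypes n E N, 2 ≤ p.1 ∧ p.1 ≤ N ∧ (startsOf E p.1).length = 2 ∧
      p.2 = pairDist n (startsOf E p.1) ∧ p.2 ≠ 0) ∧
    ((separatedTypes n E N).map Prod.fst).Nodup ∧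
    ∀ p ∈ separatedTypes n E N, ∀ q ∈ separatedTypes n E N, p.2 = q.2 → p = q := by
  induction N with
  | zero => simp [separatedTypes]
  | succ N ih =>
    obtain ⟨h1, h2, h3⟩ := ih
    have hstep : separatedTypes n E (N + 1) =
      bif !Nat.beq N 0 && Nat.beq (startsOf E (N + 1)).length 2 &&
        !Nat.beq (pairDist n (startsOf E (N + 1))) 0 &&
        listAll (fun p => !Nat.beq p.2 (pairDist n (startsOf E (N + 1)))) (separatedTypes n E N)
      then (N + 1, pairDist n (startsOf E (N + 1))) :: separatedTypes n E N
      else separatedTypes n E N := rfl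
    rw [hstep, Bool.cond_eq_ite]
    split_ifs with hc
    · simp only [Bool.and_eq_true, listAll_iff, Bool.not_eq_true', Bool.eq_false_iff, ne_eq,
        Nat.beq_eq] at hc
      obtain ⟨⟨⟨c1, c2⟩, c3⟩, c4⟩ := hc
      refine ⟨?_, ?_, ?_⟩
      · intro p hp
        rcases List.mem_cons.mp hp with rfl | hp
        · exact ⟨by simp only; omega, le_rfl, c2, rfl, c3⟩
        · obtain ⟨a, b, c⟩ := h1 p hp
          exact ⟨a, by omega, c⟩
      · rw [List.map_cons, List.nodup_cons]
        refine ⟨fun h => ?_, h2⟩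
        obtain ⟨p, hp, h⟩ := List.mem_map.mp h
        have := (h1 p hp).2.1
        simp only at h
        omega
      · intro p hp q hq hpq
        rcases List.mem_cons.mp hp with rfl | hp <;> rcases List.mem_cons.mp hq with rfl | hq
        · rfl
        · exact absurd hpq.symm (c4 q hq)
        · exact absurd hpq (c4 p hp)
        · exact h3 p hp q hq hpq
    · exact ⟨fun p hp => ⟨(h1 p hp).1, by have := (h1 p hp).2.1; omega, (h1 p hp).2.2⟩, h2, h3⟩

theorem orientedPair_spec {n : ℕ} {S : List ℕ} (hn : n % 2 = 1) (hS : ∀ a ∈ S, a < n)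
    (h : S.length = 2) (hd : pairDist n S ≠ 0) :
    (orientedPair n S).1 ∈ S ∧ (orientedPair n S).2 ∈ S ∧
      (∀ a ∈ S, a = (orientedPair n S).1 ∨ a = (orientedPair n S).2) ∧
      2 * pairDist n S < n ∧
      ((pairDist n S : ℕ) : ZMod n) = ((orientedPair n S).1 : ZMod n) - (orientedPair n S).2 := by
  obtain ⟨a, b, rfl⟩ := List.length_eq_two.mp h
  have ha := hS a (by simp)
  have hb := hS b (by simp)
  rw [pairDist] at hd ⊢
  rw [orientedPair] at hd ⊢
  rw [Bool.cond_eq_ite] at hd ⊢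
  split_ifs at hd ⊢ with hc
  · rw [Nat.ble_eq] at hc
    refine ⟨by simp, by simp, by simp, by simp only; omega, ?_⟩
    exact natCast_mod_sub (by simp only; omega)
  · rw [Nat.ble_eq] at hc
    refine ⟨by simp, by simp, by simp [or_comm], ?_, natCast_mod_sub (by simp only; omega)⟩
    simp only at hd ⊢
    rcases Nat.lt_or_ge a b with h | h
    · rw [show b + n - a = b - a + n by omega, Nat.add_mod_right, Nat.mod_eq_of_lt (by omega)]
      rw [Nat.mod_eq_of_lt (by omega)] at hc
      omega
    · rw [show a + n - b = a - b + n by omega, Nat.add_mod_right, Nat.mod_eq_of_lt (by omega)] at hc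
      rw [Nat.mod_eq_of_lt (by omega)]
      omega

theorem hasSeparatorPath_of_pathCheck {n : ℕ} {L : List ℕ} (h : pathCheck n L = true) :
    HasSeparatorPath n := by
  simp only [pathCheck, Bool.and_eq_true, listAll_iff, allBelow_iff, Bool.not_eq_true',
    Bool.eq_false_iff, ne_eq, Nat.beq_eq, Nat.blt_eq, Nat.ble_eq] at h
  obtain ⟨⟨⟨⟨⟨hn, hL⟩, hlt⟩, hnd⟩, hty⟩, hbound⟩ := h
  replace hnd := nodup_of_allDistinct hnd
  set E := typeStarts n L with hE
  have hget : ∀ j, j < L.length → L.getD j 0 < n := by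
    intro j hj
    rw [List.getD_eq_getElem _ _ hj]
    exact hlt _ (List.getElem_mem hj)
  have hinj : ∀ i j, i < L.length → j < L.length → L.getD i 0 = L.getD j 0 → i = j := by
    intro i j hi hj h
    rw [List.getD_eq_getElem _ _ hi, List.getD_eq_getElem _ _ hj] at h
    exact (hnd.getElem_inj_iff).mp h
  have hspec : ∀ j, j + 1 < L.length → _ := fun j hj =>
    typeStart_spec (hget j (by omega)) (hget (j + 1) hj)
      (fun h => by have := hinj _ _ (by omega) hj h; omega)
  have hEmem : ∀ x v, (x, v) ∈ E → x ∈ edgeTypes n ∧ v < n := by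
    intro x v hxv
    obtain ⟨j, hj, h⟩ := mem_typeStarts.mp hxv
    have := hspec j hj
    rw [← h] at this
    exact ⟨this.1, this.2.1⟩
  obtain ⟨s1, s2, s3⟩ := separatedTypes_spec n E (n / 2)
  have hF : ∀ x ∈ ((separatedTypes n E (n / 2)).map Prod.fst).toFinset,
      (x, pairDist n (startsOf E x)) ∈ separatedTypes n E (n / 2) := by
    intro x hx
    obtain ⟨p, hp, rfl⟩ := List.mem_map.mp (List.mem_toFinset.mp hx)
    rw [← (s1 p hp).2.2.2.1]
    exact hp
  have hpair : ∀ x ∈ ((separatedTypes n E (n / 2)).map Prod.fst).toFinset, _ := fun x hx =>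
    orientedPair_spec hn (fun a ha => (hEmem x a (mem_startsOf.mp ha)).2) (s1 _ (hF x hx)).2.2.1
      (s1 _ (hF x hx)).2.2.2.2
  refine hasSeparatorPath_of_rel (R := fun x v => ∃ a : ℕ, (x, a) ∈ E ∧ v = a) hn
    (fun j => ((L.getD j 0 : ℕ) : ZMod n)) (L.length - 1) ?_ ?_ ?_ ?_
    ((separatedTypes n E (n / 2)).map Prod.fst).toFinset
    (fun x => ((orientedPair n (startsOf E x)).1 : ℕ))
    (fun x => ((orientedPair n (startsOf E x)).2 : ℕ)) (fun x => pairDist n (startsOf E x))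
    ?_ ?_ ?_ ?_ ?_ ?_ ?_
  · intro i hi j hj h
    rw [ZMod.natCast_eq_natCast_iff', Nat.mod_eq_of_lt (hget i (by omega)),
      Nat.mod_eq_of_lt (hget j (by omega))] at h
    exact hinj i j (by omega) (by omega) h
  · ext e
    constructor
    · rintro ⟨j, hj, rfl⟩
      refine ⟨_, _, ⟨_, mem_typeStarts.mpr ⟨j, by omega, rfl⟩, rfl⟩, ?_⟩
      rw [Int.cast_natCast]
      exact (hspec j (by omega)).2.2
    · rintro ⟨x, v, ⟨a, ha, rfl⟩, rfl⟩
      obtain ⟨j, hj, h⟩ := mem_typeStarts.mp ha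
      refine ⟨j, by omega, ?_⟩
      have := (hspec j hj).2.2
      rw [← h] at this
      rw [Int.cast_natCast]
      exact this.symm
  · rintro x v ⟨a, ha, -⟩
    exact (hEmem x a ha).1
  · intro x hx
    rw [edgeTypes, Finset.mem_Icc] at hx
    have h := (hty (x - 1) (by omega)).1
    rw [Nat.sub_add_cancel hx.1] at h
    obtain ⟨a, ha⟩ := List.exists_mem_of_length_pos (Nat.pos_of_ne_zero h)
    exact ⟨a, a, mem_startsOf.mp ha, rfl⟩
  · exact fun x hx => ⟨_, mem_startsOf.mp (hpair x hx).1, rfl⟩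
  · exact fun x hx => ⟨_, mem_startsOf.mp (hpair x hx).2.1, rfl⟩
  · rintro x hx v ⟨a, ha, rfl⟩
    simp only [Nat.cast_inj]
    exact (hpair x hx).2.2.1 a (mem_startsOf.mpr ha)
  · intro x hx
    refine ⟨Nat.pos_of_ne_zero (s1 _ (hF x hx)).2.2.2.2, (hpair x hx).2.2.2.1, ?_⟩
    rw [(hpair x hx).2.2.2.2]
    push_cast
    rfl
  · intro x hx y hy h
    exact congrArg Prod.fst (s3 _ (hF x hx) _ (hF y hy) h)
  · intro x hx _
    rw [edgeTypes, Finset.mem_Icc] at hx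
    have h := (hty (x - 1) (by omega)).2
    rw [Nat.sub_add_cancel hx.1, spacingCheck, Bool.cond_eq_ite] at h
    have hcard : ((startsOf E x).map (Nat.cast : ℕ → ℤ)).toFinset.card ≤ (startsOf E x).length :=
      (List.toFinset_card_le _).trans (by simp)
    refine ⟨((startsOf E x).map (Nat.cast : ℕ → ℤ)).toFinset, ?_, ?_⟩
    · rintro v ⟨a, ha, rfl⟩
      exact List.mem_toFinset.mpr (List.mem_map_of_mem (mem_startsOf.mpr ha))
    · split_ifs at h with hc
      · rw [Nat.ble_eq] at hc
        exact .inl (hcard.trans hc)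
      · right
        simp only [List.any_eq_true, allBelow_iff, Bool.not_eq_true', Bool.eq_false_iff, ne_eq,
          Nat.beq_eq] at h
        obtain ⟨u, hu, v, hv, h⟩ := h
        refine ⟨u, v, ⟨u, mem_startsOf.mp hu, rfl⟩, ⟨v, mem_startsOf.mp hv, rfl⟩, ?_⟩
        intro m h0 hm hdvd
        have hvn := (hEmem x v (mem_startsOf.mp hv)).2
        refine h (m - 1) (by omega) ?_
        rw [Nat.sub_add_cancel h0]
        apply Nat.mod_eq_zero_of_dvd
        -- The test uses `u + n - v` to stay in the naturals; this changes the product only by a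
        -- multiple of `n`.
        zify [show v ≤ u + n by omega]
        rw [show (m : ℤ) * (u + n - v) = m * (u - v) + m * n by ring]
        exact dvd_add hdvd (Dvd.intro_left _ rfl)
  · have hlen : ((separatedTypes n E (n / 2)).map Prod.fst).toFinset.card =
        (separatedTypes n E (n / 2)).length := by
      rw [List.toFinset_card_of_nodup s2, List.length_map]
    have hsub : ((separatedTypes n E (n / 2)).map Prod.fst).toFinset ⊆ edgeTypes n := by
      intro x hx
      have := s1 _ (hF x hx)
      rw [edgeTypes, Finset.mem_Icc]
      omega
    have hone : 1 ∉ ((separatedTypes n E (n / 2)).map Prod.fst).toFinset := fun h => by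
      have := (s1 _ (hF 1 h)).1
      omega
    have hlog : Nat.log2 n = Nat.log 2 n := Nat.log2_eq_log_two
    rw [hlog] at hbound
    rcases Nat.eq_zero_or_pos (n / 2) with h0 | h0
    · have h1 : edgeTypes n = ∅ := by rw [edgeTypes, h0]; rfl
      rw [h1, Finset.empty_sdiff, Finset.empty_union, Finset.card_singleton]
      omega
    · have h1 : (edgeTypes n \ ((separatedTypes n E (n / 2)).map Prod.fst).toFinset) ∪ {1} =
          edgeTypes n \ ((separatedTypes n E (n / 2)).map Prod.fst).toFinset := by
        rw [Finset.union_eq_left, Finset.singleton_subset_iff, Finset.mem_sdiff]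
        exact ⟨by rw [edgeTypes, Finset.mem_Icc]; omega, hone⟩
      rw [h1, Finset.card_sdiff_of_subset hsub, hlen, edgeTypes, Nat.card_Icc]
      omega

theorem hasSeparatorPath_of_le {n : ℕ} (hn : n % 6 = 3 ∨ n % 6 = 5) (h : n < 145) :
    HasSeparatorPath n := by
  have hmem : ∀ n < 145, (n % 6 = 3 ∨ n % 6 = 5) → n ∈ smallPaths.map Prod.fst := by decide +kernel
  obtain ⟨p, hp, rfl⟩ := List.mem_map.mp (hmem n h hn)
  exact hasSeparatorPath_of_pathCheck (smallPaths_check p hp)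

/-! ### The five-zigzag path: its vertices. -/

/-- Constraints on the parameters of the five-zigzag path in `K_n`, where `n = 8t + 2r + 1`. -/
structure FiveZigzagParams (n t r J b : ℕ) : Prop where
  n_eq : n = 8 * t + 2 * r + 1
  r_lt : r < 4
  J_pos : 0 < J
  J_le : J ≤ t
  J_mod : (J + 2 * t) % 3 ≠ 0
  b_mod : (b + J + 2 * t) % 3 = 0
  t_lt : t + 1 ≤ 4 * J
  le_b : 3 * t + 1 ≤ b
  lt_b : 2 * t + 3 * J + 3 ≤ b
  b_lt : b + 1 ≤ 4 * t + r
  room : b + 3 * t + 4 * J + 7 + r / 3 < n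

/-- The vertex sequence running through five zigzags, each with step sizes one and three. -/
def fiveZigzag (n t J b : ℕ) (j : ℕ) : ℤ :=
  if j < 2 * J + 2 then
    if j % 2 = 0 then b + t + 4 * J + 5 + (j / 2 : ℕ) else b + t + 4 * J + 3 - 3 * (j / 2 : ℕ)
  else if j < 4 * J + 3 then
    if j % 2 = 0 then b + t + J + 2 - ((j - (2 * J + 2)) / 2 : ℕ)
    else b + t + J + 4 + 3 * ((j - (2 * J + 2)) / 2 : ℕ)
  else if j < 4 * J + 2 * t + 5 then
    if j % 2 = 1 then b + 1 + t - ((j - (4 * J + 3)) / 2 : ℕ)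
    else b - 3 * t + 3 * ((j - (4 * J + 3)) / 2 : ℕ)
  else if j < 4 * J + 4 * t + 7 then
    if j % 2 = 1 then 3 * ((j - (4 * J + 2 * t + 5)) / 2 : ℕ)
    else -1 - ((j - (4 * J + 2 * t + 5)) / 2 : ℕ)
  else
    if j % 2 = 1 then n - t - 2 - ((j - (4 * J + 4 * t + 7)) / 2 : ℕ)
    else 4 * J - t + 3 * ((j - (4 * J + 4 * t + 7)) / 2 : ℕ)

/-- The last index of `fiveZigzag`. -/
def fiveZigzagLast (t r J : ℕ) : ℕ := 4 * J + 4 * t + 7 + 2 * (t - J) + (r - 1)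

/-- One case for each end of each zigzag. The third zigzag is traversed from long edges to short
ones, so its parameter is reversed to `t - m`; with this, `m` is `x / 4` for the edges `4m`, `4m +
1` at its left end. -/
theorem fiveZigzag_cases {n t r J b : ℕ} (h : FiveZigzagParams n t r J b) {j : ℕ}
    (hj : j ≤ fiveZigzagLast t r J) :
    (∃ m : ℕ, m ≤ J ∧ j = 2 * m ∧ fiveZigzag n t J b j = b + t + 4 * J + 5 + m) ∨
    (∃ m : ℕ, m ≤ J ∧ j = 2 * m + 1 ∧ fiveZigzag n t J b j = b + t + 4 * J + 3 - 3 * m) ∨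
    (∃ m : ℕ, m ≤ J ∧ j = 2 * J + 2 + 2 * m ∧ fiveZigzag n t J b j = b + t + J + 2 - m) ∨
    (∃ m : ℕ, m < J ∧ j = 2 * J + 2 + 2 * m + 1 ∧
      fiveZigzag n t J b j = b + t + J + 4 + 3 * m) ∨
    (∃ m : ℕ, m ≤ t ∧ j = 4 * J + 3 + 2 * (t - m) ∧ fiveZigzag n t J b j = b + 1 + m) ∨
    (∃ m : ℕ, m ≤ t ∧ j = 4 * J + 3 + 2 * (t - m) + 1 ∧ fiveZigzag n t J b j = b - 3 * m) ∨
    (∃ m : ℕ, m ≤ t ∧ j = 4 * J + 2 * t + 5 + 2 * m ∧ fiveZigzag n t J b j = 3 * m) ∨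
    (∃ m : ℕ, m ≤ t ∧ j = 4 * J + 2 * t + 5 + 2 * m + 1 ∧ fiveZigzag n t J b j = -1 - m) ∨
    (∃ m : ℕ, m ≤ t - J + r / 3 ∧ j = 4 * J + 4 * t + 7 + 2 * m ∧
      fiveZigzag n t J b j = n - t - 2 - m) ∨
    (∃ m : ℕ, 2 * m < 2 * (t - J) + (r - 1) ∧ j = 4 * J + 4 * t + 7 + 2 * m + 1 ∧
      fiveZigzag n t J b j = 4 * J - t + 3 * m) := by
  obtain ⟨h1, h2, h3, h4, -, -, -, -, -, -, -⟩ := h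
  rw [fiveZigzagLast] at hj
  rw [fiveZigzag]
  split_ifs
  · exact .inl ⟨j / 2, by omega, by omega, rfl⟩
  · exact .inr <| .inl ⟨j / 2, by omega, by omega, rfl⟩
  · exact .inr <| .inr <| .inl ⟨(j - (2 * J + 2)) / 2, by omega, by omega, rfl⟩
  · exact .inr <| .inr <| .inr <| .inl ⟨(j - (2 * J + 2)) / 2, by omega, by omega, rfl⟩
  · exact .inr <| .inr <| .inr <| .inr <| .inl
      ⟨t - (j - (4 * J + 3)) / 2, by omega, by omega, by omega⟩
  · exact .inr <| .inr <| .inr <| .inr <| .inr <| .inl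
      ⟨t - (j - (4 * J + 3)) / 2, by omega, by omega, by omega⟩
  · exact .inr <| .inr <| .inr <| .inr <| .inr <| .inr <| .inl
      ⟨(j - (4 * J + 2 * t + 5)) / 2, by omega, by omega, rfl⟩
  · exact .inr <| .inr <| .inr <| .inr <| .inr <| .inr <| .inr <| .inl
      ⟨(j - (4 * J + 2 * t + 5)) / 2, by omega, by omega, rfl⟩
  · exact .inr <| .inr <| .inr <| .inr <| .inr <| .inr <| .inr <| .inr <| .inl
      ⟨(j - (4 * J + 4 * t + 7)) / 2, by omega, by omega, rfl⟩
  · exact .inr <| .inr <| .inr <| .inr <| .inr <| .inr <| .inr <| .inr <| .inr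
      ⟨(j - (4 * J + 4 * t + 7)) / 2, by omega, by omega, rfl⟩

/-- The window has length `n`, so distinctness mod `n` reduces to distinctness of integers. `room`
keeps the first zigzag below the left ends of the last one. -/
theorem fiveZigzag_mem_window {n t r J b : ℕ} (h : FiveZigzagParams n t r J b) {j : ℕ}
    (hj : j ≤ fiveZigzagLast t r J) :
    -1 - (t : ℤ) ≤ fiveZigzag n t J b j ∧ fiveZigzag n t J b j < n - 1 - t := by
  have hc := fiveZigzag_cases h hj
  obtain ⟨h1, h2, h3, h4, h5, h6, h7, h8, h9, h10, h11⟩ := h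
  rcases hc with ⟨m, hm, -, h⟩ | ⟨m, hm, -, h⟩ | ⟨m, hm, -, h⟩ | ⟨m, hm, -, h⟩ | ⟨m, hm, -, h⟩ |
    ⟨m, hm, -, h⟩ | ⟨m, hm, -, h⟩ | ⟨m, hm, -, h⟩ | ⟨m, hm, -, h⟩ | ⟨m, hm, -, h⟩ <;>
  rw [h] <;> omega

-- By `J_mod` and `b_mod`, `b` is nonzero mod 3 and `4J - t ≡ -b`, so the progressions `b - 3m`,
-- `3m`, `4J - t + 3m` are in different classes mod 3. The first two zigzags have step-3 ends in
-- neighbouring classes. Every other coincidence is excluded by position: `t_lt` and `le_b` keep the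
-- overlapping progressions positive, away from `-1 - m`, and `room` separates the two extremes.
set_option maxHeartbeats 4000000 in
theorem fiveZigzag_injOn {n t r J b : ℕ} (h : FiveZigzagParams n t r J b) {i j : ℕ}
    (hi : i ≤ fiveZigzagLast t r J) (hj : j ≤ fiveZigzagLast t r J)
    (hij : fiveZigzag n t J b i = fiveZigzag n t J b j) : i = j := by
  have hci := fiveZigzag_cases h hi
  have hcj := fiveZigzag_cases h hj
  obtain ⟨h1, h2, h3, h4, h5, h6, h7, h8, h9, h10, h11⟩ := h
  clear hi hj
  rcases hci with ⟨m, hm, hi, h⟩ | ⟨m, hm, hi, h⟩ | ⟨m, hm, hi, h⟩ | ⟨m, hm, hi, h⟩ |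
    ⟨m, hm, hi, h⟩ | ⟨m, hm, hi, h⟩ | ⟨m, hm, hi, h⟩ | ⟨m, hm, hi, h⟩ | ⟨m, hm, hi, h⟩ |
    ⟨m, hm, hi, h⟩ <;>
  rcases hcj with ⟨l, hl, hj, h'⟩ | ⟨l, hl, hj, h'⟩ | ⟨l, hl, hj, h'⟩ | ⟨l, hl, hj, h'⟩ |
    ⟨l, hl, hj, h'⟩ | ⟨l, hl, hj, h'⟩ | ⟨l, hl, hj, h'⟩ | ⟨l, hl, hj, h'⟩ | ⟨l, hl, hj, h'⟩ |
    ⟨l, hl, hj, h'⟩ <;>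
  rw [h, h'] at hij <;> clear h h' <;> omega

section Values

variable {n t J b m j : ℕ}

theorem fiveZigzag_fst_right (hm : m ≤ J) (hj : j = 2 * m) :
    fiveZigzag n t J b j = b + t + 4 * J + 5 + m := by
  unfold fiveZigzag
  split_ifs <;> omega

theorem fiveZigzag_fst_left (hm : m ≤ J) (hj : j = 2 * m + 1) :
    fiveZigzag n t J b j = b + t + 4 * J + 3 - 3 * m := by
  unfold fiveZigzag
  split_ifs <;> omega

theorem fiveZigzag_snd_left (hm : m ≤ J) (hj : j = 2 * J + 2 + 2 * m) :
    fiveZigzag n t J b j = b + t + J + 2 - m := by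
  unfold fiveZigzag
  split_ifs <;> omega

theorem fiveZigzag_snd_right (hm : m < J) (hj : j = 2 * J + 2 + 2 * m + 1) :
    fiveZigzag n t J b j = b + t + J + 4 + 3 * m := by
  unfold fiveZigzag
  split_ifs <;> omega

theorem fiveZigzag_trd_right (hm : m ≤ t) (hj : j = 4 * J + 3 + 2 * (t - m)) :
    fiveZigzag n t J b j = b + 1 + m := by
  unfold fiveZigzag
  split_ifs <;> omega

theorem fiveZigzag_trd_left (hm : m ≤ t) (hj : j = 4 * J + 3 + 2 * (t - m) + 1) :
    fiveZigzag n t J b j = b - 3 * m := by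
  unfold fiveZigzag
  split_ifs <;> omega

theorem fiveZigzag_fth_right (hm : m ≤ t) (hj : j = 4 * J + 2 * t + 5 + 2 * m) :
    fiveZigzag n t J b j = 3 * m := by
  unfold fiveZigzag
  split_ifs <;> omega

theorem fiveZigzag_fth_left (hm : m ≤ t) (hj : j = 4 * J + 2 * t + 5 + 2 * m + 1) :
    fiveZigzag n t J b j = -1 - m := by
  unfold fiveZigzag
  split_ifs <;> omega

theorem fiveZigzag_last_left (hj : j = 4 * J + 4 * t + 7 + 2 * m) :
    fiveZigzag n t J b j = n - t - 2 - m := by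
  unfold fiveZigzag
  split_ifs <;> omega

theorem fiveZigzag_last_right (hj : j = 4 * J + 4 * t + 7 + 2 * m + 1) :
    fiveZigzag n t J b j = 4 * J - t + 3 * m := by
  unfold fiveZigzag
  split_ifs <;> omega

end Values

theorem fiveZigzag_cast_injOn {n t r J b : ℕ} (h : FiveZigzagParams n t r J b) {i j : ℕ}
    (hi : i ≤ fiveZigzagLast t r J) (hj : j ≤ fiveZigzagLast t r J)
    (hij : (fiveZigzag n t J b i : ZMod n) = fiveZigzag n t J b j) : i = j := by
  refine fiveZigzag_injOn h hi hj ?_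
  have h1 := fiveZigzag_mem_window h hi
  have h2 := fiveZigzag_mem_window h hj
  rw [ZMod.intCast_eq_intCast_iff] at hij
  obtain ⟨c, hc⟩ := hij.dvd
  have hn : (0 : ℤ) < n := by have := h.n_eq; omega
  have hc1 : c < 1 := by
    by_contra hc'
    nlinarith
  have hc2 : -1 < c := by
    by_contra hc'
    nlinarith
  obtain rfl : c = 0 := by omega
  omega

/-! ### The edges of the five-zigzag path. -/

/-- Types and starting vertices of the edges of the path `fiveZigzag`. -/
def FiveZigzagEdge (t r J b : ℕ) (x : ℕ) (v : ℤ) : Prop :=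
  (x % 4 = 2 ∧ x / 4 ≤ J ∧ v = b + t + 4 * J + 3 - 3 * (x / 4 : ℕ)) ∨
  (x % 4 = 3 ∧ x / 4 < J ∧ v = b + t + 4 * J + 3 - 3 * (x / 4 : ℕ)) ∨
  (x = 1 ∧ v = b + t + J + 2) ∨
  (x % 4 = 2 ∧ x / 4 < J ∧ v = b + t + J + 2 - (x / 4 : ℕ)) ∨
  (x % 4 = 3 ∧ x / 4 < J ∧ v = b + t + J + 1 - (x / 4 : ℕ)) ∨
  (x = 1 ∧ v = b + 1 + t) ∨
  (x % 4 = 1 ∧ x ≤ 4 * t + r ∧ v = b - 3 * (x / 4 : ℕ)) ∨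
  (r = 0 ∧ x = 4 * t ∧ v = b + 1 + t) ∨
  (x % 4 = 0 ∧ 0 < x ∧ x ≤ 4 * t ∧ v = b - 3 * (x / 4 : ℕ)) ∨
  (x = b ∧ v = 0) ∨
  (x % 4 = 1 ∧ x ≤ 4 * t + r ∧ v = -1 - (x / 4 : ℕ)) ∨
  (r = 0 ∧ x = 4 * t ∧ v = 3 * t) ∨
  (x % 4 = 0 ∧ 0 < x ∧ x ≤ 4 * t ∧ v = -(x / 4 : ℕ)) ∨
  (x = 1 ∧ v = -t - 2) ∨
  (x % 4 = 2 ∧ J ≤ x / 4 ∧ x ≤ 4 * t + r ∧ v = J - t - 2 - (x / 4 : ℕ)) ∨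
  (x % 4 = 3 ∧ J ≤ x / 4 ∧ x ≤ 4 * t + r ∧ v = J - t - 3 - (x / 4 : ℕ))

/-- The integer vertices are not normalized relative to the starts, so endpoints are allowed to be
off by `n`. -/
theorem edge_cast_eq {n x : ℕ} {p q v : ℤ}
    (h : ((p = v ∨ p = v + n) ∧ (q = v + x ∨ q = v + x + n ∨ q = v + x - n)) ∨
      ((q = v ∨ q = v + n) ∧ (p = v + x ∨ p = v + x + n ∨ p = v + x - n))) :
    s((p : ZMod n), (q : ZMod n)) = s((v : ZMod n), (v : ZMod n) + (x : ZMod n)) := by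
  rcases h with ⟨rfl | rfl, rfl | rfl | rfl⟩ | ⟨rfl | rfl, rfl | rfl | rfl⟩ <;>
    simp [Sym2.eq_swap]

theorem exists_fiveZigzagEdge {n t r J b : ℕ} (h : FiveZigzagParams n t r J b) {j : ℕ}
    (hj : j < fiveZigzagLast t r J) :
    ∃ (x : ℕ) (v : ℤ), FiveZigzagEdge t r J b x v ∧
      (((fiveZigzag n t J b j = v ∨ fiveZigzag n t J b j = v + n) ∧
        (fiveZigzag n t J b (j + 1) = v + x ∨ fiveZigzag n t J b (j + 1) = v + x + n ∨
          fiveZigzag n t J b (j + 1) = v + x - n)) ∨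
      ((fiveZigzag n t J b (j + 1) = v ∨ fiveZigzag n t J b (j + 1) = v + n) ∧
        (fiveZigzag n t J b j = v + x ∨ fiveZigzag n t J b j = v + x + n ∨
          fiveZigzag n t J b j = v + x - n))) := by
  have hcj := fiveZigzag_cases h hj.le
  rw [fiveZigzagLast] at hj
  obtain ⟨h1, h2, h3, h4, h5, h6, h7, h8, h9, h10, h11⟩ := h
  rcases hcj with ⟨m, hm, hj', hp⟩ | ⟨m, hm, hj', hp⟩ | ⟨m, hm, hj', hp⟩ | ⟨m, hm, hj', hp⟩ |
    ⟨m, hm, hj', hp⟩ | ⟨m, hm, hj', hp⟩ | ⟨m, hm, hj', hp⟩ | ⟨m, hm, hj', hp⟩ |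
    ⟨m, hm, hj', hp⟩ | ⟨m, hm, hj', hp⟩ <;> rw [hp] <;> clear hp
  · rw [fiveZigzag_fst_left hm (by omega)]
    exact ⟨4 * m + 2, b + t + 4 * J + 3 - 3 * m,
        .inl ⟨by omega, by omega, by omega⟩, by omega⟩
  · rcases hm.lt_or_eq with hm' | rfl
    · rw [fiveZigzag_fst_right (m := m + 1) hm' (by omega)]
      exact ⟨4 * m + 3, b + t + 4 * J + 3 - 3 * m,
        .inr <| .inl ⟨by omega, by omega, by omega⟩, by omega⟩
    · rw [fiveZigzag_snd_left (m := 0) (by omega) (by omega)]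
      exact ⟨1, b + t + m + 2,
        .inr <| .inr <| .inl ⟨by omega, by omega⟩, by omega⟩
  · rcases hm.lt_or_eq with hm' | rfl
    · rw [fiveZigzag_snd_right hm' (by omega)]
      exact ⟨4 * m + 2, b + t + J + 2 - m,
        .inr <| .inr <| .inr <| .inl ⟨by omega, by omega, by omega⟩, by omega⟩
    · rw [fiveZigzag_trd_right le_rfl (by omega)]
      exact ⟨1, b + 1 + t,
        .inr <| .inr <| .inr <| .inr <| .inr <| .inl ⟨by omega, by omega⟩, by omega⟩
  · rw [fiveZigzag_snd_left (m := m + 1) hm (by omega)]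
    exact ⟨4 * m + 3, b + t + J + 2 - (m + 1),
        .inr <| .inr <| .inr <| .inr <| .inl ⟨by omega, by omega, by omega⟩, by omega⟩
  · rw [fiveZigzag_trd_left hm (by omega)]
    -- When `r = 0`, the difference `4t + 1` exceeds `n / 2`; the edge is read from its other end
    -- and has type `n - (4t + 1) = 4t`.
    by_cases hr : r = 0 ∧ m = t
    · exact ⟨4 * t, b + 1 + t,
        .inr <| .inr <| .inr <| .inr <| .inr <| .inr <| .inr <| .inl ⟨by omega, by omega, by omega⟩, by omega⟩
    · exact ⟨4 * m + 1, b - 3 * m,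
        .inr <| .inr <| .inr <| .inr <| .inr <| .inr <| .inl ⟨by omega, by omega, by omega⟩, by omega⟩
  · rcases Nat.eq_zero_or_pos m with rfl | hm'
    · rw [fiveZigzag_fth_right (m := 0) (by omega) (by omega)]
      exact ⟨b, 0,
        .inr <| .inr <| .inr <| .inr <| .inr <| .inr <| .inr <| .inr <|
          .inr <| .inl ⟨by omega, by omega⟩, by omega⟩
    · rw [fiveZigzag_trd_right (m := m - 1) (by omega) (by omega)]
      exact ⟨4 * m, b - 3 * m,
        .inr <| .inr <| .inr <| .inr <| .inr <| .inr <| .inr <| .inr <|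
          .inl ⟨by omega, by omega, by omega, by omega⟩, by omega⟩
  · rw [fiveZigzag_fth_left hm (by omega)]
    by_cases hr : r = 0 ∧ m = t
    · exact ⟨4 * t, 3 * t,
        .inr <| .inr <| .inr <| .inr <| .inr <| .inr <| .inr <| .inr <|
          .inr <| .inr <| .inr <| .inl ⟨by omega, by omega, by omega⟩, by omega⟩
    · exact ⟨4 * m + 1, -1 - m,
        .inr <| .inr <| .inr <| .inr <| .inr <| .inr <| .inr <| .inr <|
          .inr <| .inr <| .inl ⟨by omega, by omega, by omega⟩, by omega⟩
  · rcases hm.lt_or_eq with hm' | rfl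
    · rw [fiveZigzag_fth_right (m := m + 1) hm' (by omega)]
      exact ⟨4 * (m + 1), -(m + 1),
        .inr <| .inr <| .inr <| .inr <| .inr <| .inr <| .inr <| .inr <|
          .inr <| .inr <| .inr <| .inr <| .inl ⟨by omega, by omega, by omega, by omega⟩, by omega⟩
    · rw [fiveZigzag_last_left (m := 0) (by omega)]
      exact ⟨1, -m - 2,
        .inr <| .inr <| .inr <| .inr <| .inr <| .inr <| .inr <| .inr <|
          .inr <| .inr <| .inr <| .inr <| .inr <| .inl ⟨by omega, by omega⟩, by omega⟩
  · rw [fiveZigzag_last_right (m := m) (by omega)]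
    exact ⟨4 * (m + J) + 2, J - t - 2 - (m + J),
        .inr <| .inr <| .inr <| .inr <| .inr <| .inr <| .inr <| .inr <|
          .inr <| .inr <| .inr <| .inr <| .inr <| .inr <| .inl ⟨by omega, by omega, by omega, by omega⟩, by omega⟩
  · rw [fiveZigzag_last_left (m := m + 1) (by omega)]
    exact ⟨4 * (m + J) + 3, J - t - 3 - (m + J),
        .inr <| .inr <| .inr <| .inr <| .inr <| .inr <| .inr <| .inr <|
          .inr <| .inr <| .inr <| .inr <| .inr <| .inr <| .inr <| ⟨by omega, by omega, by omega, by omega⟩, by omega⟩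

theorem exists_index_of_fiveZigzagEdge {n t r J b : ℕ} (h : FiveZigzagParams n t r J b) {x : ℕ}
    {v : ℤ} (hx : FiveZigzagEdge t r J b x v) :
    ∃ j < fiveZigzagLast t r J,
      ((fiveZigzag n t J b j = v ∨ fiveZigzag n t J b j = v + n) ∧
        (fiveZigzag n t J b (j + 1) = v + x ∨ fiveZigzag n t J b (j + 1) = v + x + n ∨
          fiveZigzag n t J b (j + 1) = v + x - n)) ∨
      ((fiveZigzag n t J b (j + 1) = v ∨ fiveZigzag n t J b (j + 1) = v + n) ∧
        (fiveZigzag n t J b j = v + x ∨ fiveZigzag n t J b j = v + x + n ∨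
          fiveZigzag n t J b j = v + x - n)) := by
  unfold fiveZigzagLast
  obtain ⟨h1, h2, h3, h4, h5, h6, h7, h8, h9, h10, h11⟩ := h
  obtain ⟨m, hm⟩ : ∃ m, m = x / 4 := ⟨_, rfl⟩
  rcases hx with hx | hx | hx | hx | hx | hx | hx | hx | hx | hx | hx | hx | hx | hx | hx | hx
  · refine ⟨2 * m, by omega, ?_⟩
    rw [fiveZigzag_fst_right (m := m) (by omega) rfl, fiveZigzag_fst_left (m := m) (by omega) rfl]
    omega
  · refine ⟨2 * m + 1, by omega, ?_⟩
    rw [fiveZigzag_fst_left (m := m) (by omega) rfl,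
      fiveZigzag_fst_right (m := m + 1) (by omega) (by omega)]
    omega
  · refine ⟨2 * J + 1, by omega, ?_⟩
    rw [fiveZigzag_fst_left (m := J) (by omega) rfl,
      fiveZigzag_snd_left (m := 0) (by omega) rfl]
    omega
  · refine ⟨2 * J + 2 + 2 * m, by omega, ?_⟩
    rw [fiveZigzag_snd_left (m := m) (by omega) rfl, fiveZigzag_snd_right (m := m) (by omega) rfl]
    omega
  · refine ⟨2 * J + 2 + 2 * m + 1, by omega, ?_⟩
    rw [fiveZigzag_snd_right (m := m) (by omega) rfl,
      fiveZigzag_snd_left (m := m + 1) (by omega) (by omega)]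
    omega
  · refine ⟨4 * J + 2, by omega, ?_⟩
    rw [fiveZigzag_snd_left (m := J) (by omega) (by omega),
      fiveZigzag_trd_right (m := t) (by omega) (by omega)]
    omega
  · refine ⟨4 * J + 3 + 2 * (t - m), by omega, ?_⟩
    rw [fiveZigzag_trd_right (m := m) (by omega) rfl, fiveZigzag_trd_left (m := m) (by omega) rfl]
    omega
  · refine ⟨4 * J + 3, by omega, ?_⟩
    rw [fiveZigzag_trd_right (m := t) (by omega) (by omega),
      fiveZigzag_trd_left (m := t) (by omega) (by omega)]
    omega
  · refine ⟨4 * J + 3 + 2 * (t - m) + 1, by omega, ?_⟩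
    rw [fiveZigzag_trd_left (m := m) (by omega) rfl,
      fiveZigzag_trd_right (m := m - 1) (by omega) (by omega)]
    omega
  · refine ⟨4 * J + 2 * t + 4, by omega, ?_⟩
    rw [fiveZigzag_trd_left (m := 0) (by omega) (by omega),
      fiveZigzag_fth_right (m := 0) (by omega) (by omega)]
    omega
  · refine ⟨4 * J + 2 * t + 5 + 2 * m, by omega, ?_⟩
    rw [fiveZigzag_fth_right (m := m) (by omega) rfl, fiveZigzag_fth_left (m := m) (by omega) rfl]
    omega
  · refine ⟨4 * J + 2 * t + 5 + 2 * t, by omega, ?_⟩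
    rw [fiveZigzag_fth_right (m := t) (by omega) rfl, fiveZigzag_fth_left (m := t) (by omega) rfl]
    omega
  · refine ⟨4 * J + 2 * t + 5 + 2 * (m - 1) + 1, by omega, ?_⟩
    rw [fiveZigzag_fth_left (m := m - 1) (by omega) rfl,
      fiveZigzag_fth_right (m := m) (by omega) (by omega)]
    omega
  · refine ⟨4 * J + 4 * t + 6, by omega, ?_⟩
    rw [fiveZigzag_fth_left (m := t) (by omega) (by omega),
      fiveZigzag_last_left (m := 0) (by omega)]
    omega
  · refine ⟨4 * J + 4 * t + 7 + 2 * (m - J), by omega, ?_⟩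
    rw [fiveZigzag_last_left (m := m - J) rfl, fiveZigzag_last_right (m := m - J) rfl]
    omega
  · refine ⟨4 * J + 4 * t + 7 + 2 * (m - J) + 1, by omega, ?_⟩
    rw [fiveZigzag_last_right (m := m - J) rfl, fiveZigzag_last_left (m := m - J + 1) (by omega)]
    omega

theorem seqEdges_fiveZigzag {n t r J b : ℕ} (h : FiveZigzagParams n t r J b) :
    seqEdges (fun j => (fiveZigzag n t J b j : ZMod n)) (fiveZigzagLast t r J) =
      relEdges n (FiveZigzagEdge t r J b) := by
  ext e
  constructor
  · rintro ⟨j, hj, rfl⟩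
    obtain ⟨x, v, hxv, h'⟩ := exists_fiveZigzagEdge h hj
    exact ⟨x, v, hxv, edge_cast_eq h'⟩
  · rintro ⟨x, v, hxv, rfl⟩
    obtain ⟨j, hj, h'⟩ := exists_index_of_fiveZigzagEdge h hxv
    exact ⟨j, hj, (edge_cast_eq h').symm⟩

/-! ### Distances, the size of the complement, and spacing. -/

theorem not_dvd_mul_of_lt {n M m : ℕ} {d : ℤ} (hd : 0 < d) (hM : M * d < n) (h0 : 0 < m)
    (hm : m ≤ M) : ¬ (n : ℤ) ∣ m * d := by
  intro h
  have h1 : (0 : ℤ) < m * d := by positivity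
  have h2 := Int.le_of_dvd h1 h
  have h3 : (m : ℤ) * d ≤ M * d := by gcongr
  omega

/-- Types with exactly two edges in `fiveZigzag`, at distances that occur for no other type. -/
def fiveZigzagTypes (n t r J b : ℕ) : Finset ℕ :=
  (edgeTypes n).filter fun x =>
    x ≠ 1 ∧ x ≠ b ∧ (x % 4 = 0 ∨ x % 4 = 1 ∨ x / 4 < J) ∧ ¬ (r = 0 ∧ x = 4 * t)

/-- Starting vertex of the first edge of type `x` in `fiveZigzag`. -/
def fiveZigzagStart (t J b x : ℕ) : ℤ :=
  if x % 4 = 0 ∨ x % 4 = 1 then b - 3 * (x / 4 : ℕ) else b + t + 4 * J + 3 - 3 * (x / 4 : ℕ)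

/-- Starting vertex of the second edge of type `x` in `fiveZigzag`. -/
def fiveZigzagStart' (t J b x : ℕ) : ℤ :=
  if x % 4 = 0 then -(x / 4 : ℕ) else if x % 4 = 1 then -1 - (x / 4 : ℕ)
  else if x % 4 = 2 then b + t + J + 2 - (x / 4 : ℕ) else b + t + J + 1 - (x / 4 : ℕ)

theorem mem_fiveZigzagTypes {n t r J b x : ℕ} (h : FiveZigzagParams n t r J b) :
    x ∈ fiveZigzagTypes n t r J b ↔ (1 ≤ x ∧ x ≤ 4 * t + r) ∧
      x ≠ 1 ∧ x ≠ b ∧ (x % 4 = 0 ∨ x % 4 = 1 ∨ x / 4 < J) ∧ ¬ (r = 0 ∧ x = 4 * t) := by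
  have := h.n_eq
  rw [fiveZigzagTypes, Finset.mem_filter, edgeTypes, Finset.mem_Icc,
    show n / 2 = 4 * t + r by omega]

theorem FiveZigzagEdge.mem_edgeTypes {n t r J b x : ℕ} {v : ℤ} (h : FiveZigzagParams n t r J b)
    (hx : FiveZigzagEdge t r J b x v) : x ∈ edgeTypes n := by
  obtain ⟨h1, h2, h3, h4, h5, h6, h7, h8, h9, h10, h11⟩ := h
  rw [edgeTypes, Finset.mem_Icc]
  rcases hx with hx | hx | hx | hx | hx | hx | hx | hx | hx | hx | hx | hx | hx | hx | hx | hx <;>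
    omega

theorem exists_fiveZigzagEdge_of_mem {n t r J b x : ℕ} (h : FiveZigzagParams n t r J b)
    (hx : x ∈ edgeTypes n) : ∃ v, FiveZigzagEdge t r J b x v := by
  obtain ⟨h1, h2, -⟩ := h
  rw [edgeTypes, Finset.mem_Icc] at hx
  have h4 : x % 4 < 4 := Nat.mod_lt _ (by norm_num)
  unfold FiveZigzagEdge
  rcases (by omega : x % 4 = 0 ∨ x % 4 = 1 ∨ x % 4 = 2 ∨ x % 4 = 3) with h0 | h0 | h0 | h0
  · exact ⟨b - 3 * (x / 4 : ℕ), .inr <| .inr <| .inr <| .inr <| .inr <| .inr <| .inr <| .inr <|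
      .inl ⟨h0, by omega, by omega, rfl⟩⟩
  · exact ⟨b - 3 * (x / 4 : ℕ), .inr <| .inr <| .inr <| .inr <| .inr <| .inr <|
      .inl ⟨h0, by omega, rfl⟩⟩
  · rcases Nat.lt_or_ge (x / 4) J with hJ | hJ
    · exact ⟨_, .inl ⟨h0, hJ.le, rfl⟩⟩
    · exact ⟨J - t - 2 - (x / 4 : ℕ), .inr <| .inr <| .inr <| .inr <| .inr <| .inr <| .inr <|
        .inr <| .inr <| .inr <| .inr <| .inr <| .inr <| .inr <| .inl ⟨h0, hJ, by omega, rfl⟩⟩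
  · rcases Nat.lt_or_ge (x / 4) J with hJ | hJ
    · exact ⟨_, .inr <| .inl ⟨h0, hJ, rfl⟩⟩
    · exact ⟨J - t - 3 - (x / 4 : ℕ), .inr <| .inr <| .inr <| .inr <| .inr <| .inr <| .inr <|
        .inr <| .inr <| .inr <| .inr <| .inr <| .inr <| .inr <| .inr ⟨h0, hJ, by omega, rfl⟩⟩

theorem fiveZigzagEdge_start {n t r J b x : ℕ} (h : FiveZigzagParams n t r J b)
    (hx : x ≤ 4 * t + r) (h1 : 1 ≤ x) (hx' : x % 4 = 0 ∨ x % 4 = 1 ∨ x / 4 < J) :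
    FiveZigzagEdge t r J b x (fiveZigzagStart t J b x) := by
  have hr := h.r_lt
  unfold fiveZigzagStart FiveZigzagEdge
  rcases (by omega : x % 4 = 0 ∨ x % 4 = 1 ∨ x % 4 = 2 ∨ x % 4 = 3) with h0 | h0 | h0 | h0
  · rw [if_pos (.inl h0)]
    exact .inr <| .inr <| .inr <| .inr <| .inr <| .inr <| .inr <| .inr <|
      .inl ⟨h0, by omega, by omega, rfl⟩
  · rw [if_pos (.inr h0)]
    exact .inr <| .inr <| .inr <| .inr <| .inr <| .inr <| .inl ⟨h0, by omega, rfl⟩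
  · rw [if_neg (by omega)]
    exact .inl ⟨h0, by omega, rfl⟩
  · rw [if_neg (by omega)]
    exact .inr <| .inl ⟨h0, by omega, rfl⟩

theorem fiveZigzagEdge_start' {n t r J b x : ℕ} (h : FiveZigzagParams n t r J b)
    (hx : x ≤ 4 * t + r) (h1 : 1 ≤ x) (hx' : x % 4 = 0 ∨ x % 4 = 1 ∨ x / 4 < J) :
    FiveZigzagEdge t r J b x (fiveZigzagStart' t J b x) := by
  have hr := h.r_lt
  unfold fiveZigzagStart' FiveZigzagEdge
  rcases (by omega : x % 4 = 0 ∨ x % 4 = 1 ∨ x % 4 = 2 ∨ x % 4 = 3) with h0 | h0 | h0 | h0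
  · rw [if_pos h0]
    exact .inr <| .inr <| .inr <| .inr <| .inr <| .inr <| .inr <| .inr <| .inr <| .inr <| .inr <|
      .inr <| .inl ⟨h0, by omega, by omega, rfl⟩
  · rw [if_neg (by omega), if_pos h0]
    exact .inr <| .inr <| .inr <| .inr <| .inr <| .inr <| .inr <| .inr <| .inr <| .inr <|
      .inl ⟨h0, by omega, rfl⟩
  · rw [if_neg (by omega), if_neg (by omega), if_pos h0]
    exact .inr <| .inr <| .inr <| .inl ⟨h0, by omega, rfl⟩
  · rw [if_neg (by omega), if_neg (by omega), if_neg (by omega)]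
    exact .inr <| .inr <| .inr <| .inr <| .inl ⟨h0, by omega, rfl⟩

/-- With `m = x / 4`, the differences for `x % 4 = 0, 1, 2, 3` are `b - 2m`, `b + 1 - 2m`, `3J + 1 -
2m`, `3J + 2 - 2m`. Type 1 is left out because its value `b + 1` would be isolated from the interval
ending at `b - 1`. -/
theorem fiveZigzagStart_sub {n t r J b x : ℕ} (h : FiveZigzagParams n t r J b)
    (h1 : 2 ≤ x) (hx : x ≤ 4 * t + r) (hx' : x % 4 = 0 ∨ x % 4 = 1 ∨ x / 4 < J) :
    0 < fiveZigzagStart t J b x - fiveZigzagStart' t J b x ∧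
      fiveZigzagStart t J b x - fiveZigzagStart' t J b x ≤ 4 * t + r := by
  obtain ⟨-, h2, h3, h4, -, -, h7, h8, h9, h10, -⟩ := h
  unfold fiveZigzagStart fiveZigzagStart'
  split_ifs <;> omega

theorem fiveZigzagEdge_eq_start {n t r J b x : ℕ} {v : ℤ} (h : FiveZigzagParams n t r J b)
    (hx : x ∈ fiveZigzagTypes n t r J b) (hv : FiveZigzagEdge t r J b x v) :
    v = fiveZigzagStart t J b x ∨ v = fiveZigzagStart' t J b x := by
  rw [mem_fiveZigzagTypes h] at hx
  unfold fiveZigzagStart fiveZigzagStart'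
  rcases hv with hv | hv | hv | hv | hv | hv | hv | hv | hv | hv | hv | hv | hv | hv | hv | hv <;>
    split_ifs <;> omega

/-- Within a pair of zigzags, parity separates the two residue classes. Across the pairs, `lt_b`
gives `3J + 2 < b - 2t`. -/
theorem fiveZigzagStart_sub_injOn {n t r J b x y : ℕ} (h : FiveZigzagParams n t r J b)
    (hx : x ∈ fiveZigzagTypes n t r J b) (hy : y ∈ fiveZigzagTypes n t r J b)
    (hxy : fiveZigzagStart t J b x - fiveZigzagStart' t J b x =
      fiveZigzagStart t J b y - fiveZigzagStart' t J b y) : x = y := by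
  rw [mem_fiveZigzagTypes h] at hx hy
  obtain ⟨-, h2, h3, h4, -, -, h7, h8, h9, h10, -⟩ := h
  unfold fiveZigzagStart fiveZigzagStart' at hxy
  split_ifs at hxy <;> omega

/-- Besides `1`, `b` and possibly `4t`, only the types 2, 3 mod 4 from `4J + 2` on are lost. The
truncated `r - 1` counts those above `4t`: none for `r ≤ 1`, then `4t + 2` and `4t + 3`. -/
theorem card_sdiff_fiveZigzagTypes_le {n t r J b : ℕ} (h : FiveZigzagParams n t r J b) :
    ((edgeTypes n \ fiveZigzagTypes n t r J b) ∪ {1}).card ≤ 3 + (2 * (t - J) + (r - 1)) := by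
  have hsub : (edgeTypes n \ fiveZigzagTypes n t r J b) ∪ {1} ⊆
      {1, b, 4 * t} ∪ (Finset.range (2 * (t - J) + (r - 1))).image
        fun i => 4 * J + 2 + 4 * (i / 2) + i % 2 := by
    intro x hx
    rw [Finset.mem_union, Finset.mem_sdiff, mem_fiveZigzagTypes h, edgeTypes, Finset.mem_Icc,
      Finset.mem_singleton] at hx
    rw [Finset.mem_union, Finset.mem_image]
    simp only [Finset.mem_insert, Finset.mem_singleton, Finset.mem_range]
    by_cases h0 : x = 1 ∨ x = b ∨ x = 4 * t
    · exact .inl h0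
    · obtain ⟨h1, h2, h3, h4, -, -, -, -, -, -, -⟩ := h
      right
      by_cases h' : x % 4 = 2
      · exact ⟨2 * (x / 4 - J), by omega, by omega⟩
      · exact ⟨2 * (x / 4 - J) + 1, by omega, by omega⟩
  refine (Finset.card_le_card hsub).trans ((Finset.card_union_le _ _).trans ?_)
  exact Nat.add_le_add Finset.card_le_three (Finset.card_image_le.trans (by simp))

theorem exists_starts_of_notMem {n t r J b x : ℕ} (h : FiveZigzagParams n t r J b)
    (hx : x ∈ edgeTypes n) (hxF : x ∉ fiveZigzagTypes n t r J b) :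
    ∃ S : Finset ℤ, (∀ v, FiveZigzagEdge t r J b x v → v ∈ S) ∧
      (S.card ≤ 2 ∨ ∃ u v, FiveZigzagEdge t r J b x u ∧ FiveZigzagEdge t r J b x v ∧
        ∀ m : ℕ, 0 < m → m ≤ S.card → ¬ (n : ℤ) ∣ m * (u - v)) := by
  have hF := (mem_fiveZigzagTypes (x := x) h).not.mp hxF
  have hstart := fiveZigzagEdge_start (x := x) h
  have hstart' := fiveZigzagEdge_start' (x := x) h
  have hsub := fiveZigzagStart_sub (x := x) h
  obtain ⟨h1, h2, h3, h4, h5, h6, h7, h8, h9, h10, h11⟩ := h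
  rw [edgeTypes, Finset.mem_Icc] at hx
  by_cases hx1 : x = 1
  · subst hx1
    -- Three links and the shortest edges of the third and fourth zigzags have type 1. The starts
    -- `-1` and `-t - 2` differ by `t + 1`, and `5 (t + 1) < n`.
    refine ⟨{(b : ℤ) + t + J + 2, (b : ℤ) + 1 + t, (b : ℤ), -1, -(t : ℤ) - 2}, ?_,
      .inr ⟨-1, -t - 2, ?_, ?_, ?_⟩⟩
    · intro v hv
      simp only [Finset.mem_insert, Finset.mem_singleton]
      rcases hv with hv | hv | hv | hv | hv | hv | hv | hv | hv | hv | hv | hv | hv | hv | hv | hv <;>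
        omega
    · exact .inr <| .inr <| .inr <| .inr <| .inr <| .inr <| .inr <| .inr <| .inr <| .inr <|
        .inl ⟨rfl, by omega, rfl⟩
    · exact .inr <| .inr <| .inr <| .inr <| .inr <| .inr <| .inr <| .inr <| .inr <| .inr <| .inr <|
        .inr <| .inr <| .inl ⟨rfl, rfl⟩
    · intro m h0 hm
      exact not_dvd_mul_of_lt (M := 5) (by omega) (by push_cast; omega) h0
        (hm.trans Finset.card_le_five)
  by_cases hxt : r = 0 ∧ x = 4 * t
  · obtain ⟨hr, rfl⟩ := hxt
    -- Type `4t` also receives the two edges of difference `4t + 1`. The chosen pair differs by `b -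
    -- 2t < 2t`, so four times it stays below `n`.
    refine ⟨{(b : ℤ) - 3 * t, -(t : ℤ), (b : ℤ) + 1 + t, 3 * (t : ℤ)}, ?_,
      .inr ⟨(b : ℤ) - 3 * t, -t, ?_, ?_, ?_⟩⟩
    · intro v hv
      simp only [Finset.mem_insert, Finset.mem_singleton]
      rcases hv with hv | hv | hv | hv | hv | hv | hv | hv | hv | hv | hv | hv | hv | hv | hv | hv <;>
        omega
    · exact .inr <| .inr <| .inr <| .inr <| .inr <| .inr <| .inr <| .inr <|
        .inl ⟨by omega, by omega, le_rfl, by omega⟩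
    · exact .inr <| .inr <| .inr <| .inr <| .inr <| .inr <| .inr <| .inr <| .inr <| .inr <| .inr <|
        .inr <| .inl ⟨by omega, by omega, le_rfl, by omega⟩
    · intro m h0 hm
      exact not_dvd_mul_of_lt (M := 4) (by omega) (by push_cast; omega) h0
        (hm.trans Finset.card_le_four)
  by_cases hx' : x % 4 = 0 ∨ x % 4 = 1 ∨ x / 4 < J
  · obtain rfl : x = b := by
      by_contra hb
      exact hF ⟨by omega, hx1, hb, hx', hxt⟩
    -- The third start, 0, is that of the link from the third zigzag to the fourth.
    refine ⟨{fiveZigzagStart t J x x, fiveZigzagStart' t J x x, 0}, ?_,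
      .inr ⟨fiveZigzagStart t J x x, fiveZigzagStart' t J x x,
        hstart (by omega) (by omega) hx', hstart' (by omega) (by omega) hx', ?_⟩⟩
    · intro v hv
      simp only [Finset.mem_insert, Finset.mem_singleton]
      unfold fiveZigzagStart fiveZigzagStart'
      rcases hv with hv | hv | hv | hv | hv | hv | hv | hv | hv | hv | hv | hv | hv | hv | hv | hv <;>
        split_ifs <;> omega
    · intro m h0 hm
      refine not_dvd_mul_of_lt (M := 3) (hsub (by omega) (by omega) hx').1 ?_ h0
        (hm.trans Finset.card_le_three)
      unfold fiveZigzagStart fiveZigzagStart'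
      push_cast
      split_ifs <;> omega
  · by_cases hxb : x = b
    · subst hxb
      refine ⟨{if x % 4 = 2 then (J : ℤ) - t - 2 - (x / 4 : ℕ) else (J : ℤ) - t - 3 - (x / 4 : ℕ),
        0}, ?_, .inl Finset.card_le_two⟩
      intro v hv
      simp only [Finset.mem_insert, Finset.mem_singleton]
      rcases hv with hv | hv | hv | hv | hv | hv | hv | hv | hv | hv | hv | hv | hv | hv | hv | hv <;>
        split_ifs <;> omega
    -- The second start is attained only for `x = 4J + 2`, the longest edge of the first zigzag;
    -- otherwise the set is merely larger than needed.
    · refine ⟨{if x % 4 = 2 then (J : ℤ) - t - 2 - (x / 4 : ℕ) else (J : ℤ) - t - 3 - (x / 4 : ℕ),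
        (b : ℤ) + t + 4 * J + 3 - 3 * (x / 4 : ℕ)}, ?_, .inl Finset.card_le_two⟩
      intro v hv
      simp only [Finset.mem_insert, Finset.mem_singleton]
      rcases hv with hv | hv | hv | hv | hv | hv | hv | hv | hv | hv | hv | hv | hv | hv | hv | hv <;>
        split_ifs <;> omega

theorem FiveZigzagParams.hasSeparatorPath {n t r J b : ℕ} (h : FiveZigzagParams n t r J b)
    (hcard : 32 * (3 + (2 * (t - J) + (r - 1))) ≤ 5 * n + 16 * Nat.log 2 n + 167) :
    HasSeparatorPath n := by
  have hn := h.n_eq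
  have hsub : ∀ x ∈ fiveZigzagTypes n t r J b,
      0 < fiveZigzagStart t J b x - fiveZigzagStart' t J b x ∧
        fiveZigzagStart t J b x - fiveZigzagStart' t J b x ≤ 4 * t + r := by
    intro x hx
    rw [mem_fiveZigzagTypes h] at hx
    exact fiveZigzagStart_sub h (by omega) (by omega) hx.2.2.2.1
  refine hasSeparatorPath_of_rel (by omega) _ _
    (fun i hi j hj hij => fiveZigzag_cast_injOn h hi hj hij) (seqEdges_fiveZigzag h)
    (fun x v hv => hv.mem_edgeTypes h) (fun x hx => exists_fiveZigzagEdge_of_mem h hx)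
    (fiveZigzagTypes n t r J b) (fiveZigzagStart t J b) (fiveZigzagStart' t J b)
    (fun x => (fiveZigzagStart t J b x - fiveZigzagStart' t J b x).toNat) ?_ ?_
    (fun x hx v hv => fiveZigzagEdge_eq_start h hx hv) ?_ ?_
    (fun x hx hxF => exists_starts_of_notMem h hx hxF)
    ((Nat.mul_le_mul_left _ (card_sdiff_fiveZigzagTypes_le h)).trans hcard)
  · intro x hx
    rw [mem_fiveZigzagTypes h] at hx
    exact fiveZigzagEdge_start h hx.1.2 hx.1.1 hx.2.2.2.1
  · intro x hx
    rw [mem_fiveZigzagTypes h] at hx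
    exact fiveZigzagEdge_start' h hx.1.2 hx.1.1 hx.2.2.2.1
  · intro x hx
    have := hsub x hx
    refine ⟨by omega, by omega, ?_⟩
    rw [← Int.cast_natCast (R := ZMod n), Int.toNat_of_nonneg (by omega)]
  · intro x hx y hy hxy
    have h1 := hsub x hx
    have h2 := hsub y hy
    exact fiveZigzagStart_sub_injOn h hx hy (by omega)

/-! ### Choice of parameters and conclusion. -/

theorem exists_fiveZigzagParams {n : ℕ} (hn : n % 6 = 3 ∨ n % 6 = 5) (h : 145 ≤ n) :
    ∃ t r J b, FiveZigzagParams n t r J b ∧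
      32 * (3 + (2 * (t - J) + (r - 1))) ≤ 5 * n + 16 * 7 + 167 := by
  obtain ⟨t, r, hr, rfl⟩ : ∃ t r, r < 4 ∧ n = 8 * t + 2 * r + 1 :=
    ⟨n / 8, n % 8 / 2, by omega, by omega⟩
  -- With `b ≤ 2t + 3J + 5`, `room` follows from `7J + 12 ≤ 3t`. The largest such `J` is taken, or
  -- one less when it violates the congruence.
  obtain ⟨J, hJ, hJ1, hJ2⟩ : ∃ J, (J + 2 * t) % 3 ≠ 0 ∧ 7 * J + 12 ≤ 3 * t ∧
      (3 * t ≤ 7 * J + 18 ∨ (3 * t ≤ 7 * J + 25 ∧ (J + 1 + 2 * t) % 3 = 0)) := by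
    by_cases h0 : ((3 * t - 12) / 7 + 2 * t) % 3 = 0
    · exact ⟨(3 * t - 12) / 7 - 1, by omega, by omega, by omega⟩
    · exact ⟨(3 * t - 12) / 7, by omega, by omega, by omega⟩
  obtain ⟨c, hc, hc1, hc2⟩ : ∃ c, (c = 3 * t + 1 ∨ c = 2 * t + 3 * J + 3) ∧
      3 * t + 1 ≤ c ∧ 2 * t + 3 * J + 3 ≤ c := by
    rcases Nat.lt_or_ge (3 * t + 1) (2 * t + 3 * J + 3) with h' | h'
    · exact ⟨_, .inr rfl, h'.le, le_rfl⟩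
    · exact ⟨_, .inl rfl, le_rfl, h'⟩
  -- The least `b` above both lower bounds in the required class mod 3.
  obtain ⟨b, hb, hcb, hbc⟩ : ∃ b, (b + J + 2 * t) % 3 = 0 ∧ c ≤ b ∧ b ≤ c + 2 :=
    ⟨c + (3 - (c + J + 2 * t) % 3) % 3, by omega, by omega, by omega⟩
  have ht : t + 1 ≤ 4 * J ∧ 32 * (3 + (2 * (t - J) + (r - 1))) ≤
      5 * (8 * t + 2 * r + 1) + 16 * 7 + 167 := by
    -- For small `t` the rounding in `J` matters and each value is checked; from `t = 30` on, the
    -- linear slack between `1/7` and `5/32` suffices.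
    rcases Nat.lt_or_ge t 30 with h' | h'
    · have : 18 ≤ t := by omega
      interval_cases t <;> omega
    · omega
  refine ⟨t, r, J, b, ⟨rfl, hr, ?_, ?_, hJ, hb, ?_, ?_, ?_, ?_, ?_⟩, ?_⟩
  · omega
  · omega
  · exact ht.1
  · omega
  · omega
  · omega
  · omega
  · exact ht.2

theorem mainTheorem3 (n : ℕ) (hn : n ≡ 3 [MOD 6] ∨ n ≡ 5 [MOD 6]) :
    ∃ (a b : ZMod n) (P : (⊤ : SimpleGraph (ZMod n)).Walk a b) (F : Finset ℕ),
      P.IsPath ∧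
      IsFSeparator n {e | e ∈ P.edges} F ∧
      (∀ x ∈ edgeTypes n, ¬ HasEquallySpacedEdges n {e | e ∈ P.edges} x) ∧
      ((((edgeTypes n \ F) ∪ {1}).card : ℕ) : ℝ) ≤
        (5 * (n : ℝ) + 16 * Real.logb 2 (n : ℝ) + 167) / 32 := by
  refine HasSeparatorPath.of_integer_bound ?_
  rcases Nat.lt_or_ge n 145 with h | h
  · exact hasSeparatorPath_of_le hn h
  · obtain ⟨t, r, J, b, hp, hcard⟩ := exists_fiveZigzagParams hn h
    -- The logarithm serves only as the constant 7, available since `n ≥ 128`.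
    have hlog : 7 ≤ Nat.log 2 n := Nat.le_log_of_pow_le (by norm_num) (by omega)
    exact hp.hasSeparatorPath (by omega)
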